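/- All logarithms are to base $2$. Let $h(p)=-p\log_2 p-(1-p)\log_2(1-p)$ and let $h^{-1}:[0,1]\to[0,1/2]$ be the inverse of the restriction of $h$ to $[0,1/2]$. For $0<t\le 1$ put $\eta_t=(1-2h^{-1}(1-t))^2$ and $\alpha_t=t/\eta_t$ (for $t=0$, where $\eta_0=0$, put $\alpha_0=0$). A binary-input memoryless channel $W$ with input $X\in\{0,1\}$ and output $Y$ in an arbitrary measurable space is called BMS (binary-input memoryless output-symmetric) if there is a (possibly randomized) sufficient statistic $T(Y)=(X\oplus Z_A,A)$ for $X$, where $(A,Z_A)\in[0,1]\times\{0,1\}$ is independent of $X$ and $\Pr(Z_A=1\mid A=a)=a$. The capacity of $W$ is $\sup_{P_X} I(X;Y)$. The binary erasure channel $\mathrm{BEC}$ with parameter $t\in[0,1]$ outputs its input with probability $t$ and an erasure symbol with probability $1-t$. Then, for every $t\in[0,1]$, the binary erasure channel with parameter $t$ has capacity $t$, and the following holds. Let $n\ge 0$, let $C\subset\{0,1\}^n$ be a linear code (a linear subspace of $\mathbb F_2^n$), let $u\in\{0,1\}^n$, and let $X^n$ be uniformly distributed on $C+u$. For every BMS channel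 of capacity $t$, $$\alpha_t\cdot I_{\mathrm{BEC}}^{(t)}(X^n;Y^n)\le I_{\mathrm{BMS}}^{(t)}(X^n;Y^n)\le I_{\mathrm{BEC}}^{(t)}(X^n;Y^n),$$ where $I_{\mathrm{BMS}}^{(t)}(X^n;Y^n)$ and $I_{\mathrm{BEC}}^{(t)}(X^n;Y^n)$ denote the mutual information between $X^n$ and the output of $n$ independent uses of, respectively, that BMS channel and the binary erasure channel of capacity $t$. Moreover, $\alpha_t>\frac{\log_2 e}{2}$ for all $0<t\le 1$. -/

import Mathlib

open MeasureTheory ProbabilityTheory Set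
open scoped ENNReal

noncomputable section

namespace BMSComparison

/-- The binary entropy function, in bits. -/
def h (p : ℝ) : ℝ := Real.binEntropy p / Real.log 2

/-- The inverse of the binary entropy function restricted to `[0, 1/2]`. -/
def hInv : ℝ → ℝ := Function.invFunOn h (Icc 0 (1 / 2))

/-- `η_t = (1 - 2 h⁻¹(1 - t))²`. -/
def eta (t : ℝ) : ℝ := (1 - 2 * hInv (1 - t)) ^ 2

/-- `α_t = t / η_t`. -/
def alpha (t : ℝ) : ℝ := t / eta t

/-- Mutual information `I(X;Y) = D(P_XY ‖ P_X × P_Y)`, in bits, of a pair with joint law `ρ`. -/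
def mutualInfo {α β : Type*} [MeasurableSpace α] [MeasurableSpace β] (ρ : Measure (α × β)) :
    ℝ≥0∞ :=
  InformationTheory.klDiv ρ (ρ.fst.prod ρ.snd) / ENNReal.ofReal (Real.log 2)

/-- `I(P, W)`: mutual information between an input with law `P` and the output of the channel `W`
fed with it. -/
def channelInfo {α β : Type*} [MeasurableSpace α] [MeasurableSpace β] (P : Measure α)
    (W : Kernel α β) : ℝ≥0∞ :=
  mutualInfo (P ⊗ₘ W)

/-- The capacity of a channel: the supremum of `I(P, W)` over all input distributions `P`. -/
def capacity {α β : Type*} [MeasurableSpace α] [MeasurableSpace β] (W : Kernel α β) : ℝ≥0∞ :=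
  ⨆ (P : Measure α) (_ : IsProbabilityMeasure P), channelInfo P W

/-- The memoryless extension `W^{⊗n}` of a binary-input channel `W`: given the input `x`, the
outputs are independent and the `i`-th one has law `W (x i)`. -/
def memoryless {β : Type*} [MeasurableSpace β] (W : Kernel (ZMod 2) β) (n : ℕ) :
    Kernel (Fin n → ZMod 2) (Fin n → β) where
  toFun x := Measure.pi fun i => W (x i)
  measurable' := Measurable.of_discrete

/-- The binary erasure channel with erasure probability `1 - t`, where `0 ≤ t ≤ 1`;
`Sum.inr ()` is the erasure symbol. -/
def bec (t : ℝ) : Kernel (ZMod 2) (ZMod 2 ⊕ Unit) where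
  toFun x := ENNReal.ofReal t • Measure.dirac (Sum.inl x) +
    ENNReal.ofReal (1 - t) • Measure.dirac (Sum.inr ())
  measurable' := Measurable.of_discrete

/-- The (possibly randomized) statistic `T`, generated from the output `Y` of the channel `W` by
the kernel `κ`, is sufficient for the input `X`: for each event `B` there is a version of
`Pr(Y ∈ B | T = s, X = x)` that does not depend on `x`.
A deterministic statistic `T = f(Y)` is the case `κ = Kernel.deterministic f _`. -/
def IsSufficient {α β S : Type*} [MeasurableSpace α] [MeasurableSpace β] [MeasurableSpace S]
    (W : Kernel α β) (κ : Kernel β S) : Prop :=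
  ∀ B : Set β, MeasurableSet B → ∃ g : S → ℝ≥0∞, Measurable g ∧
    ∀ (x : α) (D : Set S), MeasurableSet D →
      (W x ⊗ₘ κ) (B ×ˢ D) = ∫⁻ s in D, g s ∂(W x ⊗ₘ κ).snd

/-- A binary-input channel `W` is a BMS channel if it has a sufficient statistic
`T = (X ⊕ Z_A, A)` for its input `X`, where `(Z_A, A)` has a law `Q` that does not depend on the
input and `Pr(Z_A = 1 | A = a) = a`. -/
def IsBMS {β : Type*} [MeasurableSpace β] (W : Kernel (ZMod 2) β) : Prop :=
  ∃ (κ : Kernel β (ZMod 2 × unitInterval)) (Q : Measure (ZMod 2 × unitInterval)),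
    IsMarkovKernel κ ∧ IsProbabilityMeasure Q ∧
    IsSufficient W κ ∧
    (∀ D : Set unitInterval, MeasurableSet D →
      Q ({1} ×ˢ D) = ∫⁻ a in D, ENNReal.ofReal (a : ℝ) ∂Q.snd) ∧
    ∀ x : ZMod 2, (W x ⊗ₘ κ).snd = Q.map fun p => (x + p.1, p.2)

/-- The uniform distribution on the shifted linear code `C + u`. -/
def unifShiftedCode {n : ℕ} (C : Submodule (ZMod 2) (Fin n → ZMod 2)) (u : Fin n → ZMod 2) :
    Measure (Fin n → ZMod 2) :=
  uniformOn ((fun c => c + u) '' (C : Set (Fin n → ZMod 2)))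

end BMSComparison

end

/-! A symmetric channel is described by the law `ν` of its bias `m`: under the average output law
`μ` the input bit with sign `s` has likelihood `1 + s m`, and `m` is symmetric. Let `d(m)` be
`deficit m`, the entropy deficit in nats. It equals `∑ c_k m^(2k+2)` with all `c_k > 0` and `∑ c_k =
log 2`. If the current bias of a bit is `b`, one use of the channel yields information `E[d(m) -
d(bm)]`. The capacity is therefore `E d(m) / log 2`, attained at `b = 0`. Both bounds reduce to
inequalities for `d`. Working with unnormalized posteriors (`tilt`) under the reference law `μ`
makes successive observations commute.

Upper bound. Chebyshev's inequality gives `d(b) d(m) ≤ log 2 · d(bm)`. Hence one use yields at most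
`t (log 2 - d(b))`, the yield of the erasure channel (`step_negEntropy_le`). Since observations
commute, the channel uses can be exchanged one at a time (`steps_le_steps`).

Lower bound. Let `η = E m²`. Since `d(bm) ≤ b² d(m)`, a new observation yields at least `E d(m)`
times the posterior variance `1 - b²` of its bit. That variance is on average no smaller than after
observations through the erasure channel with parameter `η` (`step_becLaw_signVar_le`). Under a
uniform law on an affine space, erasures leave each bit either known or uniform, so there the yield
is exactly `η log 2 (1 - b²)`. Summing by the chain rule gives the factor `t/η` relative to the
erasure channel with parameter `η` (`mul_steps_becLaw_sub_le`). Since `t ≤ η`, that channel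
dominates the one with parameter `t`.

Finally `u ↦ d(√u)` is convex, so Jensen gives `η ≤ η_t` (`alpha_le_div_integral_sq`). The bound on
`α_t` is `d(m) > m²/2`. -/

noncomputable section

namespace BMSComparison

/-! ### The entropy deficit of a biased bit -/

/-- The entropy deficit `log 2 - H` (in nats) of a bit with bias `m`. -/
def deficit (m : ℝ) : ℝ := ((1 + m) * Real.log (1 + m) + (1 - m) * Real.log (1 - m)) / 2

/-- The power series coefficients of `deficit` in `m ^ 2`. -/
def deficitCoeff (k : ℕ) : ℝ := 1 / ((2 * k + 1) * (2 * k + 2))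

lemma deficitCoeff_pos (k : ℕ) : 0 < deficitCoeff k := by
  unfold deficitCoeff; positivity

lemma continuous_deficit : Continuous deficit := by
  unfold deficit
  have := Real.continuous_mul_log
  exact ((this.comp (continuous_const.add continuous_id)).add
    (this.comp (continuous_const.sub continuous_id))).div_const 2

lemma measurable_deficit : Measurable deficit := continuous_deficit.measurable

lemma deficit_zero : deficit 0 = 0 := by simp [deficit]

lemma deficit_one : deficit 1 = Real.log 2 := by
  norm_num [deficit]

lemma deficit_neg (m : ℝ) : deficit (-m) = deficit m := by
  unfold deficit
  rw [← sub_eq_add_neg, sub_neg_eq_add, add_comm]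

lemma binEntropy_eq_sub_deficit (m : ℝ) :
    Real.binEntropy ((1 - m) / 2) = Real.log 2 - deficit m := by
  have h1 : ∀ x : ℝ, x / 2 * Real.log (x / 2) = (x * Real.log x - x * Real.log 2) / 2 := by
    intro x
    rcases eq_or_ne x 0 with rfl | hx
    · simp
    · rw [Real.log_div hx two_ne_zero]; ring
  have h2 : (1 : ℝ) - (1 - m) / 2 = (1 + m) / 2 := by ring
  rw [Real.binEntropy_eq_negMulLog_add_negMulLog_one_sub, h2]
  simp only [Real.negMulLog, neg_mul]
  rw [h1, h1, deficit]
  ring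

/-- Twice the deficit is `m (log(1+m) - log(1-m)) + log(1-m²)`. The two classical series combine
through `1/(2k+1) - 1/(2k+2)`. -/
lemma hasSum_deficit_of_abs_lt {m : ℝ} (hm : |m| < 1) :
    HasSum (fun k => deficitCoeff k * (m ^ 2) ^ (k + 1)) (deficit m) := by
  have hm2 : |m ^ 2| < 1 := by rw [abs_pow]; exact pow_lt_one₀ (abs_nonneg _) hm two_ne_zero
  have h1 := (Real.hasSum_log_sub_log_of_abs_lt_one hm).mul_left m
  have h2 := Real.hasSum_pow_div_log_of_abs_lt_one hm2
  have h3 := (h1.sub h2).div_const 2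
  obtain ⟨ha, hb⟩ := abs_lt.1 hm
  have e1 : (fun k : ℕ => deficitCoeff k * (m ^ 2) ^ (k + 1)) = fun k : ℕ =>
      (m * (2 * (1 / (2 * (k : ℝ) + 1)) * m ^ (2 * k + 1)) - (m ^ 2) ^ (k + 1) / (k + 1)) / 2 := by
    funext k
    have hk : (2 * (k : ℝ) + 1) ≠ 0 := by positivity
    have hk' : ((k : ℝ) + 1) ≠ 0 := by positivity
    have hk2 : (2 * (k : ℝ) + 2) ≠ 0 := by positivity
    have hm1 : m * m ^ (2 * k + 1) = (m ^ 2) ^ (k + 1) := by ring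
    have : m * (2 * (1 / (2 * (k : ℝ) + 1)) * m ^ (2 * k + 1)) =
        2 * (1 / (2 * (k : ℝ) + 1)) * (m ^ 2) ^ (k + 1) := by rw [← hm1]; ring
    rw [this, deficitCoeff]
    field_simp
    ring
  have e2 : deficit m =
      (m * (Real.log (1 + m) - Real.log (1 - m)) - -Real.log (1 - m ^ 2)) / 2 := by
    have : (1 - m ^ 2) = (1 + m) * (1 - m) := by ring
    rw [this, Real.log_mul (by linarith) (by linarith), deficit]
    ring
  rw [e1, e2]
  exact h3

/-- Each partial sum of the series is at most `deficit m` for `0 < m < 1`. By continuity this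
persists at `m = 1`, where the deficit is `log 2`. -/
lemma summable_deficitCoeff : Summable deficitCoeff := by
  have hle : ∀ n : ℕ, ∑ k ∈ Finset.range n, deficitCoeff k ≤ Real.log 2 := by
    intro n
    have hc : Continuous fun m : ℝ =>
        deficit m - ∑ k ∈ Finset.range n, deficitCoeff k * (m ^ 2) ^ (k + 1) := by
      have := continuous_deficit
      fun_prop
    have hcl : (1 : ℝ) ∈ closure (Ioo (0 : ℝ) 1) := by
      rw [closure_Ioo (by norm_num)]; simp
    have hs : IsClosed {m : ℝ |
        0 ≤ deficit m - ∑ k ∈ Finset.range n, deficitCoeff k * (m ^ 2) ^ (k + 1)} :=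
      isClosed_le continuous_const hc
    have := hs.closure_subset_iff.2 (fun (m : ℝ) (hm : m ∈ Ioo (0 : ℝ) 1) => by
      have h := hasSum_deficit_of_abs_lt (m := m) (by rw [abs_lt]; constructor <;> linarith [hm.1, hm.2])
      exact sub_nonneg.2 (sum_le_hasSum _ (fun k _ => by
        have := deficitCoeff_pos k; positivity) h)) hcl
    simpa [deficit_one] using this
  exact summable_of_sum_range_le (fun k => (deficitCoeff_pos k).le) hle

/-- The coefficients dominate the terms uniformly on `[-1, 1]`, so the sum is continuous up to the
endpoints and agrees there with `deficit`. -/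
lemma hasSum_deficit {m : ℝ} (hm : |m| ≤ 1) :
    HasSum (fun k => deficitCoeff k * (m ^ 2) ^ (k + 1)) (deficit m) := by
  have hb : ∀ (k : ℕ) (x : ℝ), x ∈ Icc (-1 : ℝ) 1 →
      ‖deficitCoeff k * (x ^ 2) ^ (k + 1)‖ ≤ deficitCoeff k := by
    intro k x hx
    have hx2 : x ^ 2 ≤ 1 := by nlinarith [hx.1, hx.2]
    rw [Real.norm_of_nonneg (by have := deficitCoeff_pos k; positivity)]
    exact mul_le_of_le_one_right (deficitCoeff_pos k).le (pow_le_one₀ (sq_nonneg x) hx2)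
  have hcont : ContinuousOn (fun x : ℝ => ∑' k, deficitCoeff k * (x ^ 2) ^ (k + 1))
      (Icc (-1) 1) :=
    continuousOn_tsum (fun k => by fun_prop) summable_deficitCoeff hb
  have heq : EqOn deficit (fun x : ℝ => ∑' k, deficitCoeff k * (x ^ 2) ^ (k + 1))
      (Icc (-1) 1) := by
    have h0 : EqOn deficit (fun x : ℝ => ∑' k, deficitCoeff k * (x ^ 2) ^ (k + 1))
        (Ioo (-1) 1) := fun x hx => (hasSum_deficit_of_abs_lt (abs_lt.2 hx)).tsum_eq.symm
    refine h0.of_subset_closure continuous_deficit.continuousOn hcont Ioo_subset_Icc_self ?_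
    rw [closure_Ioo (by norm_num)]
  have hm' : m ∈ Icc (-1 : ℝ) 1 := abs_le.1 hm
  rw [heq hm']
  exact (Summable.of_norm_bounded summable_deficitCoeff (fun k => hb k m hm')).hasSum

lemma hasSum_deficitCoeff : HasSum deficitCoeff (Real.log 2) := by
  simpa [deficit_one] using hasSum_deficit (m := 1) (by simp)

lemma sq_le_one_of_abs {m : ℝ} (hm : |m| ≤ 1) : m ^ 2 ≤ 1 := by
  rw [← sq_abs]; exact pow_le_one₀ (abs_nonneg m) hm

lemma abs_mul_le_one {a b : ℝ} (ha : |a| ≤ 1) (hb : |b| ≤ 1) : |a * b| ≤ 1 := by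
  rw [abs_mul]; exact mul_le_one₀ ha (abs_nonneg b) hb

/-- Every exponent in the series is at least `2`, so each term gains at least a factor `a²`. -/
lemma deficit_mul_le {a b : ℝ} (ha : |a| ≤ 1) (hb : |b| ≤ 1) :
    deficit (a * b) ≤ a ^ 2 * deficit b := by
  refine hasSum_le (fun k => ?_) (hasSum_deficit (abs_mul_le_one ha hb))
    ((hasSum_deficit hb).mul_left (a ^ 2))
  have h1 : (a ^ 2) ^ k ≤ 1 := pow_le_one₀ (sq_nonneg a) (sq_le_one_of_abs ha)
  have h2 : 0 ≤ a ^ 2 * (deficitCoeff k * (b ^ 2) ^ (k + 1)) := by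
    have := deficitCoeff_pos k; positivity
  calc _ = (a ^ 2 * (deficitCoeff k * (b ^ 2) ^ (k + 1))) * (a ^ 2) ^ k := by ring
    _ ≤ _ := mul_le_of_le_one_right h2 h1

lemma deficit_nonneg {m : ℝ} (hm : |m| ≤ 1) : 0 ≤ deficit m :=
  (hasSum_deficit hm).nonneg fun k => by have := deficitCoeff_pos k; positivity

lemma deficit_le_sq {m : ℝ} (hm : |m| ≤ 1) : deficit m ≤ m ^ 2 * Real.log 2 := by
  simpa [deficit_one] using deficit_mul_le hm (b := 1) (by simp)

lemma deficit_le_log_two {m : ℝ} (hm : |m| ≤ 1) : deficit m ≤ Real.log 2 :=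
  (deficit_le_sq hm).trans
    (mul_le_of_le_one_left (Real.log_nonneg one_le_two) (sq_le_one_of_abs hm))

lemma hasSum_mul_of_nonneg {f g : ℕ → ℝ} {a b : ℝ} (hf : HasSum f a) (hg : HasSum g b)
    (hf0 : ∀ k, 0 ≤ f k) (hg0 : ∀ k, 0 ≤ g k) :
    HasSum (fun p : ℕ × ℕ => f p.1 * g p.2) (a * b) :=
  hf.mul hg (hf.summable.mul_of_nonneg hg.summable hf0 hg0)

/-- Chebyshev's association inequality for the coefficients of `deficit`. -/
lemma deficit_mul_deficit_le {a b : ℝ} (ha : |a| ≤ 1) (hb : |b| ≤ 1) :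
    deficit a * deficit b ≤ Real.log 2 * deficit (a * b) := by
  have hA := hasSum_deficit ha
  have hB := hasSum_deficit hb
  have hC := hasSum_deficitCoeff
  have hAB := hasSum_deficit (abs_mul_le_one ha hb)
  have s1 := hasSum_mul_of_nonneg hC hAB (fun k => (deficitCoeff_pos k).le)
    (fun k => by have := deficitCoeff_pos k; positivity)
  have s2 := hasSum_mul_of_nonneg hAB hC (fun k => by have := deficitCoeff_pos k; positivity)
    (fun k => (deficitCoeff_pos k).le)
  have s3 := hasSum_mul_of_nonneg hA hB (fun k => by have := deficitCoeff_pos k; positivity)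
    (fun k => by have := deficitCoeff_pos k; positivity)
  have s4 := hasSum_mul_of_nonneg hB hA (fun k => by have := deficitCoeff_pos k; positivity)
    (fun k => by have := deficitCoeff_pos k; positivity)
  -- Symmetrized double sum: the termwise difference is `c_i c_j (A_i - A_j)(B_i - B_j)`, where `A`
  -- and `B` are the powers of `a²` and `b²`. It is nonnegative because both are decreasing in the
  -- index.
  have key := hasSum_le (fun p : ℕ × ℕ => ?_) (s3.add s4) (s1.add s2)
  · nlinarith [key]
  have anti : ∀ x : ℝ, |x| ≤ 1 → Antitone fun k : ℕ => (x ^ 2) ^ (k + 1) := fun x hx i j hij =>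
    pow_le_pow_of_le_one (sq_nonneg x) (sq_le_one_of_abs hx) (by omega)
  have hprod : 0 ≤ ((a ^ 2) ^ (p.1 + 1) - (a ^ 2) ^ (p.2 + 1)) *
      ((b ^ 2) ^ (p.1 + 1) - (b ^ 2) ^ (p.2 + 1)) := by
    rcases le_total p.1 p.2 with h | h
    · exact mul_nonneg (sub_nonneg.2 (anti a ha h)) (sub_nonneg.2 (anti b hb h))
    · exact mul_nonneg_of_nonpos_of_nonpos (sub_nonpos.2 (anti a ha h))
        (sub_nonpos.2 (anti b hb h))
  have hc := mul_pos (deficitCoeff_pos p.1) (deficitCoeff_pos p.2)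
  have := mul_nonneg hc.le hprod
  simp only [mul_pow] at this ⊢
  nlinarith [this]

/-- The first term of the series is `m²/2`; the second, `m⁴/12`, makes the inequality strict. -/
lemma half_sq_lt_deficit {m : ℝ} (hm : |m| ≤ 1) (h0 : m ≠ 0) : m ^ 2 / 2 < deficit m := by
  have h := sum_le_hasSum (Finset.range 2) (fun k _ => by
    have := deficitCoeff_pos k; positivity) (hasSum_deficit hm)
  simp only [Finset.sum_range_succ, Finset.range_zero, Finset.sum_empty, deficitCoeff] at h
  norm_num at h
  have : 0 < m ^ 2 := by positivity
  nlinarith [pow_pos this 2]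

lemma deficit_lt_deficit {a b : ℝ} (ha : 0 ≤ a) (hab : a < b) (hb : b ≤ 1) :
    deficit a < deficit b := by
  have hb' : |b| ≤ 1 := by rw [abs_of_nonneg (by linarith)]; exact hb
  have ha' : |a| ≤ 1 := by rw [abs_of_nonneg ha]; linarith
  have hlt : ∀ k : ℕ, deficitCoeff k * (a ^ 2) ^ (k + 1) < deficitCoeff k * (b ^ 2) ^ (k + 1) :=
    fun k => mul_lt_mul_of_pos_left (pow_lt_pow_left₀ (pow_lt_pow_left₀ hab ha two_ne_zero)
      (sq_nonneg a) (Nat.succ_ne_zero k)) (deficitCoeff_pos k)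
  exact hasSum_lt (fun k => (hlt k).le) (hlt 0) (hasSum_deficit ha') (hasSum_deficit hb')

lemma hasSum_deficit_sqrt {u : ℝ} (hu : u ∈ Icc (0 : ℝ) 1) :
    HasSum (fun k => deficitCoeff k * u ^ (k + 1)) (deficit (Real.sqrt u)) := by
  have := hasSum_deficit (m := Real.sqrt u) (by
    rw [abs_of_nonneg (Real.sqrt_nonneg u)]; exact Real.sqrt_le_one.2 hu.2)
  simpa [Real.sq_sqrt hu.1] using this

/-- In the variable `u = m²` the deficit is a nonnegative combination of the convex functions
`u^(k+1)`. -/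
lemma convexOn_deficit_sqrt : ConvexOn ℝ (Icc 0 1) fun u => deficit (Real.sqrt u) := by
  refine ⟨convex_Icc 0 1, fun x hx y hy a b ha hb hab => ?_⟩
  have hz := convex_Icc (0 : ℝ) 1 hx hy ha hb hab
  simp only [smul_eq_mul] at hz ⊢
  refine hasSum_le (fun k => ?_) (hasSum_deficit_sqrt hz)
    (((hasSum_deficit_sqrt hx).mul_left a).add ((hasSum_deficit_sqrt hy).mul_left b))
  have := (convexOn_pow (k + 1)).2 (mem_Ici.2 hx.1) (mem_Ici.2 hy.1) ha hb hab
  simp only [smul_eq_mul] at this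
  nlinarith [mul_le_mul_of_nonneg_left this (deficitCoeff_pos k).le]

/-- Jensen's inequality for the entropy deficit as a function of the squared bias. -/
lemma deficit_sqrt_integral_le {ν : Measure ℝ} [IsProbabilityMeasure ν]
    (hν : ∀ᵐ m ∂ν, |m| ≤ 1) :
    deficit (Real.sqrt (∫ m, m ^ 2 ∂ν)) ≤ ∫ m, deficit m ∂ν := by
  have h1 : ∀ᵐ m ∂ν, m ^ 2 ∈ Icc (0 : ℝ) 1 := by
    filter_upwards [hν] with m hm using ⟨sq_nonneg m, sq_le_one_of_abs hm⟩
  have heven : ∀ m : ℝ, deficit (Real.sqrt (m ^ 2)) = deficit m := by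
    intro m
    rw [Real.sqrt_sq_eq_abs]
    rcases abs_choice m with h | h <;> rw [h]
    exact deficit_neg m
  have := convexOn_deficit_sqrt.map_integral_le (μ := ν) (f := fun m => m ^ 2)
    (continuous_deficit.comp Real.continuous_sqrt).continuousOn isClosed_Icc h1 ?_ ?_
  · simpa only [heven] using this
  · exact Integrable.of_bound (by fun_prop) 1 (by
      filter_upwards [h1] with m hm
      rw [Real.norm_of_nonneg hm.1]; exact hm.2)
  · simp only [Function.comp_def, heven]
    exact Integrable.of_bound measurable_deficit.aestronglyMeasurable (Real.log 2) (by
      filter_upwards [hν] with m hm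
      rw [Real.norm_of_nonneg (deficit_nonneg hm)]; exact deficit_le_log_two hm)

/-! ### Laws of the bias and the averaging operators they induce -/

/-- A symmetric probability law on `[-1, 1]`: the law of the bias of a BMS channel. -/
structure IsBiasLaw (ν : Measure ℝ) : Prop where
  isProbabilityMeasure : IsProbabilityMeasure ν
  abs_le_one : ∀ᵐ m ∂ν, |m| ≤ 1
  map_neg : ν.map (fun m => -m) = ν

section Operators

variable {Ω : Type*}

/-- Reweighting of `w` by the likelihood of an observation of bias `m` of the sign `s`. -/
def tilt (s : Ω → ℝ) (m : ℝ) (w : Ω → ℝ) : Ω → ℝ := fun x => w x * (1 + s x * m)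

/-- Average of a functional over one observation of the sign `s`. -/
def step (ν : Measure ℝ) (s : Ω → ℝ) (Ψ : (Ω → ℝ) → ℝ) : (Ω → ℝ) → ℝ :=
  fun w => ∫ m, Ψ (tilt s m w) ∂ν

/-- Average of a functional over independent observations of the signs in a list. -/
def steps (ν : Measure ℝ) (l : List (Ω → ℝ)) (Ψ : (Ω → ℝ) → ℝ) : (Ω → ℝ) → ℝ :=
  l.foldr (step ν) Ψ

/-- The function `s` takes only the values `1` and `-1`. -/
def IsSign (s : Ω → ℝ) : Prop := ∀ x, s x = 1 ∨ s x = -1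

/-- Measurable functionals that are bounded on boxes of nonnegative weights. -/
structure IsRegular (Ψ : (Ω → ℝ) → ℝ) : Prop where
  measurable : Measurable Ψ
  bounded : ∀ R : ℝ, ∃ K : ℝ, ∀ w : Ω → ℝ, (∀ x, 0 ≤ w x) → (∀ x, w x ≤ R) → |Ψ w| ≤ K


lemma IsSign.abs_mul_le {s : Ω → ℝ} (hs : IsSign s) {m : ℝ} (hm : |m| ≤ 1) (x : Ω) :
    |s x * m| ≤ 1 := by
  rcases hs x with h | h <;> simpa [h] using hm

lemma tilt_nonneg {s : Ω → ℝ} (hs : IsSign s) {m : ℝ} (hm : |m| ≤ 1) {w : Ω → ℝ}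
    (hw : ∀ x, 0 ≤ w x) (x : Ω) : 0 ≤ tilt s m w x :=
  mul_nonneg (hw x) (by linarith [(abs_le.1 (hs.abs_mul_le hm x)).1])

lemma tilt_le {s : Ω → ℝ} (hs : IsSign s) {m : ℝ} (hm : |m| ≤ 1) {w : Ω → ℝ}
    (hw : ∀ x, 0 ≤ w x) {R : ℝ} (hR : ∀ x, w x ≤ R) (x : Ω) : tilt s m w x ≤ 2 * R := by
  have h1 := (abs_le.1 (hs.abs_mul_le hm x)).2
  unfold tilt
  nlinarith [hw x, hR x]

lemma tilt_comm (s s' : Ω → ℝ) (m m' : ℝ) (w : Ω → ℝ) :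
    tilt s m (tilt s' m' w) = tilt s' m' (tilt s m w) := by
  funext x; simp only [tilt]; ring

lemma measurable_tilt (s : Ω → ℝ) : Measurable fun p : (Ω → ℝ) × ℝ => tilt s p.2 p.1 := by
  unfold tilt
  fun_prop

lemma measurable_tilt_left (s : Ω → ℝ) (w : Ω → ℝ) : Measurable fun m => tilt s m w := by
  unfold tilt
  fun_prop

lemma IsRegular.add {Ψ Θ : (Ω → ℝ) → ℝ} (hΨ : IsRegular Ψ) (hΘ : IsRegular Θ) :
    IsRegular fun w => Ψ w + Θ w := by
  refine ⟨hΨ.measurable.add hΘ.measurable, fun R => ?_⟩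
  obtain ⟨K, hK⟩ := hΨ.bounded R
  obtain ⟨L, hL⟩ := hΘ.bounded R
  exact ⟨K + L, fun w h0 hR => (abs_add_le _ _).trans (add_le_add (hK w h0 hR) (hL w h0 hR))⟩

lemma IsRegular.const_mul {Ψ : (Ω → ℝ) → ℝ} (hΨ : IsRegular Ψ) (c : ℝ) :
    IsRegular fun w => c * Ψ w := by
  refine ⟨hΨ.measurable.const_mul c, fun R => ?_⟩
  obtain ⟨K, hK⟩ := hΨ.bounded R
  exact ⟨|c| * K, fun w h0 hR => by
    rw [abs_mul]; exact mul_le_mul_of_nonneg_left (hK w h0 hR) (abs_nonneg c)⟩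

lemma steps_const_mul (Ψ : (Ω → ℝ) → ℝ) (c : ℝ) (ν : Measure ℝ) (l : List (Ω → ℝ))
    (w : Ω → ℝ) : steps ν l (fun w => c * Ψ w) w = c * steps ν l Ψ w := by
  induction l generalizing w with
  | nil => rfl
  | cons s l ih =>
    have : steps ν l (fun w => c * Ψ w) = fun w => c * steps ν l Ψ w := funext ih
    change step ν s (steps ν l fun w => c * Ψ w) w = _
    rw [this]
    exact integral_const_mul c _

lemma steps_concat (ν : Measure ℝ) (l : List (Ω → ℝ)) (s : Ω → ℝ) (Ψ : (Ω → ℝ) → ℝ) :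
    steps ν (l ++ [s]) Ψ = steps ν l (step ν s Ψ) := by
  simp [steps]

lemma IsSign.deficit_mul {s : Ω → ℝ} (hs : IsSign s) (x : Ω) (m : ℝ) :
    deficit (s x * m) = deficit m := by
  rcases hs x with h | h <;> simp [h, deficit_neg]

lemma IsRegular.step {Ψ : (Ω → ℝ) → ℝ} (hΨ : IsRegular Ψ) {ν : Measure ℝ}
    (hν : IsBiasLaw ν) {s : Ω → ℝ} (hs : IsSign s) : IsRegular (step ν s Ψ) := by
  have := hν.isProbabilityMeasure
  refine ⟨?_, fun R => ?_⟩
  · exact ((hΨ.measurable.comp (measurable_tilt s)).stronglyMeasurable.integral_prod_right'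
      (ν := ν)).measurable
  · obtain ⟨K, hK⟩ := hΨ.bounded (2 * R)
    refine ⟨K, fun w hw hR => ?_⟩
    have := norm_integral_le_of_norm_le_const (μ := ν) (f := fun m => Ψ (tilt s m w)) (C := K) (by
      filter_upwards [hν.abs_le_one] with m hm
      exact hK _ (tilt_nonneg hs hm hw) (tilt_le hs hm hw hR))
    simpa [BMSComparison.step] using this

lemma step_congr {Ψ Θ : (Ω → ℝ) → ℝ} {ν : Measure ℝ}
    (hν : IsBiasLaw ν) {s : Ω → ℝ} (hs : IsSign s)
    (h : ∀ w : Ω → ℝ, (∀ x, 0 ≤ w x) → Ψ w = Θ w) {w : Ω → ℝ} (hw : ∀ x, 0 ≤ w x) :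
    step ν s Ψ w = step ν s Θ w := by
  refine integral_congr_ae ?_
  filter_upwards [hν.abs_le_one] with m hm using h _ (tilt_nonneg hs hm hw)

lemma IsRegular.steps {Ψ : (Ω → ℝ) → ℝ} (hΨ : IsRegular Ψ) {ν : Measure ℝ}
    (hν : IsBiasLaw ν) {l : List (Ω → ℝ)} (hl : ∀ s ∈ l, IsSign s) :
    IsRegular (steps ν l Ψ) := by
  induction l with
  | nil => exact hΨ
  | cons s l ih =>
    exact (ih fun s hs => hl s (List.mem_cons_of_mem _ hs)).step hν (hl s List.mem_cons_self)

variable [Fintype Ω]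

lemma exists_upper (w : Ω → ℝ) : ∃ R, ∀ x, w x ≤ R := by
  obtain ⟨R, hR⟩ := (Set.finite_range w).bddAbove
  exact ⟨R, fun x => hR ⟨x, rfl⟩⟩

lemma IsRegular.integrable {Ψ : (Ω → ℝ) → ℝ} (hΨ : IsRegular Ψ) {ν : Measure ℝ}
    (hν : IsBiasLaw ν) {s : Ω → ℝ} (hs : IsSign s) {w : Ω → ℝ} (hw : ∀ x, 0 ≤ w x) :
    Integrable (fun m => Ψ (tilt s m w)) ν := by
  have := hν.isProbabilityMeasure
  obtain ⟨R, hR⟩ := exists_upper w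
  obtain ⟨K, hK⟩ := hΨ.bounded (2 * R)
  refine Integrable.of_bound (hΨ.measurable.comp (measurable_tilt_left s w)).aestronglyMeasurable
    K ?_
  filter_upwards [hν.abs_le_one] with m hm
  exact hK _ (tilt_nonneg hs hm hw) (tilt_le hs hm hw hR)

lemma step_mono {Ψ Θ : (Ω → ℝ) → ℝ} (hΨ : IsRegular Ψ) (hΘ : IsRegular Θ) {ν : Measure ℝ}
    (hν : IsBiasLaw ν) {s : Ω → ℝ} (hs : IsSign s)
    (h : ∀ w : Ω → ℝ, (∀ x, 0 ≤ w x) → Ψ w ≤ Θ w) {w : Ω → ℝ} (hw : ∀ x, 0 ≤ w x) :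
    step ν s Ψ w ≤ step ν s Θ w := by
  refine integral_mono_ae (hΨ.integrable hν hs hw) (hΘ.integrable hν hs hw) ?_
  filter_upwards [hν.abs_le_one] with m hm using h _ (tilt_nonneg hs hm hw)

lemma steps_mono {Ψ Θ : (Ω → ℝ) → ℝ} (hΨ : IsRegular Ψ) (hΘ : IsRegular Θ) {ν : Measure ℝ}
    (hν : IsBiasLaw ν) {l : List (Ω → ℝ)} (hl : ∀ s ∈ l, IsSign s)
    (h : ∀ w : Ω → ℝ, (∀ x, 0 ≤ w x) → Ψ w ≤ Θ w) {w : Ω → ℝ} (hw : ∀ x, 0 ≤ w x) :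
    steps ν l Ψ w ≤ steps ν l Θ w := by
  induction l generalizing w with
  | nil => exact h w hw
  | cons s l ih =>
    have hl' : ∀ s ∈ l, IsSign s := fun s hs => hl s (List.mem_cons_of_mem _ hs)
    exact step_mono (hΨ.steps hν hl') (hΘ.steps hν hl') hν (hl s List.mem_cons_self)
      (fun w hw => ih hl' hw) hw

lemma step_add {Ψ Θ : (Ω → ℝ) → ℝ} (hΨ : IsRegular Ψ) (hΘ : IsRegular Θ) {ν : Measure ℝ}
    (hν : IsBiasLaw ν) {s : Ω → ℝ} (hs : IsSign s) {w : Ω → ℝ} (hw : ∀ x, 0 ≤ w x) :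
    step ν s (fun w => Ψ w + Θ w) w = step ν s Ψ w + step ν s Θ w :=
  integral_add (hΨ.integrable hν hs hw) (hΘ.integrable hν hs hw)

lemma steps_add {Ψ Θ : (Ω → ℝ) → ℝ} (hΨ : IsRegular Ψ) (hΘ : IsRegular Θ) {ν : Measure ℝ}
    (hν : IsBiasLaw ν) {l : List (Ω → ℝ)} (hl : ∀ s ∈ l, IsSign s) {w : Ω → ℝ}
    (hw : ∀ x, 0 ≤ w x) :
    steps ν l (fun w => Ψ w + Θ w) w = steps ν l Ψ w + steps ν l Θ w := by
  induction l generalizing w with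
  | nil => rfl
  | cons s l ih =>
    have hl' : ∀ s ∈ l, IsSign s := fun s hs => hl s (List.mem_cons_of_mem _ hs)
    have hs := hl s List.mem_cons_self
    exact (step_congr hν hs (fun w hw => ih hl' hw) hw).trans
      (step_add (hΨ.steps hν hl') (hΘ.steps hν hl') hν hs hw)

/-- Reweightings commute pointwise and Fubini exchanges the averages. This is what permits replacing
channel uses individually. -/
lemma step_comm {Ψ : (Ω → ℝ) → ℝ} (hΨ : IsRegular Ψ) {ν ν' : Measure ℝ}
    (hν : IsBiasLaw ν) (hν' : IsBiasLaw ν') {s s' : Ω → ℝ} (hs : IsSign s) (hs' : IsSign s')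
    {w : Ω → ℝ} (hw : ∀ x, 0 ≤ w x) :
    step ν s (step ν' s' Ψ) w = step ν' s' (step ν s Ψ) w := by
  have := hν.isProbabilityMeasure
  have := hν'.isProbabilityMeasure
  obtain ⟨R, hR⟩ := exists_upper w
  obtain ⟨K, hK⟩ := hΨ.bounded (2 * (2 * R))
  have hmeas : Measurable fun p : ℝ × ℝ => tilt s' p.2 (tilt s p.1 w) :=
    (measurable_tilt s').comp
      (((measurable_tilt_left s w).comp measurable_fst).prodMk measurable_snd)
  have hint : Integrable (Function.uncurry fun m m' => Ψ (tilt s' m' (tilt s m w)))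
      (ν.prod ν') := by
    refine Integrable.of_bound (hΨ.measurable.comp hmeas).aestronglyMeasurable K ?_
    have h1 : ∀ᵐ p ∂(ν.prod ν'), |p.1| ≤ 1 := Measure.quasiMeasurePreserving_fst.ae hν.abs_le_one
    have h2 : ∀ᵐ p ∂(ν.prod ν'), |p.2| ≤ 1 := Measure.quasiMeasurePreserving_snd.ae hν'.abs_le_one
    filter_upwards [h1, h2] with p hp1 hp2
    exact hK _ (tilt_nonneg hs' hp2 (tilt_nonneg hs hp1 hw))
      (tilt_le hs' hp2 (tilt_nonneg hs hp1 hw) (tilt_le hs hp1 hw hR))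
  unfold step
  rw [integral_integral_swap hint]
  simp only [tilt_comm s' s]

/-- If one observation with law `ν` is dominated by one with law `ν'` then the same holds after
averaging over further observations. -/
lemma step_steps_le {Ψ : (Ω → ℝ) → ℝ} (hΨ : IsRegular Ψ) {ν ν' : Measure ℝ}
    (hν : IsBiasLaw ν) (hν' : IsBiasLaw ν') {s : Ω → ℝ} (hs : IsSign s)
    (h : ∀ w : Ω → ℝ, (∀ x, 0 ≤ w x) → step ν s Ψ w ≤ step ν' s Ψ w)
    {l : List (Ω → ℝ)} (hl : ∀ s ∈ l, IsSign s) {w : Ω → ℝ} (hw : ∀ x, 0 ≤ w x) :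
    step ν s (steps ν' l Ψ) w ≤ step ν' s (steps ν' l Ψ) w := by
  induction l generalizing w with
  | nil => exact h w hw
  | cons k l ih =>
    have hl' : ∀ s ∈ l, IsSign s := fun s hs => hl s (List.mem_cons_of_mem _ hs)
    have hk := hl k List.mem_cons_self
    have hr := hΨ.steps hν' hl'
    change step ν s (step ν' k (steps ν' l Ψ)) w ≤ step ν' s (step ν' k (steps ν' l Ψ)) w
    -- The observation of `s` is moved past that of `k`, so that the induction hypothesis applies
    -- under the average over `k`.
    rw [step_comm hr hν hν' hs hk hw, step_comm hr hν' hν' hs hk hw]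
    exact step_mono (hr.step hν hs) (hr.step hν' hs) hν' hk (fun w hw => ih hl' hw) hw

/-- Hybrid argument: the tail is exchanged by induction under the first observation, then the first
observation is exchanged in front of a tail already governed by `ν'`. -/
lemma steps_le_steps {Ψ : (Ω → ℝ) → ℝ} (hΨ : IsRegular Ψ) {ν ν' : Measure ℝ}
    (hν : IsBiasLaw ν) (hν' : IsBiasLaw ν') {l : List (Ω → ℝ)} (hl : ∀ s ∈ l, IsSign s)
    (h : ∀ s ∈ l, ∀ w : Ω → ℝ, (∀ x, 0 ≤ w x) → step ν s Ψ w ≤ step ν' s Ψ w)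
    {w : Ω → ℝ} (hw : ∀ x, 0 ≤ w x) :
    steps ν l Ψ w ≤ steps ν' l Ψ w := by
  induction l generalizing w with
  | nil => exact le_rfl
  | cons k l ih =>
    have hl' : ∀ s ∈ l, IsSign s := fun s hs => hl s (List.mem_cons_of_mem _ hs)
    have hk := hl k List.mem_cons_self
    exact (step_mono (hΨ.steps hν hl') (hΨ.steps hν' hl') hν hk
      (fun w hw => ih hl' (fun s hs => h s (List.mem_cons_of_mem _ hs)) hw) hw).trans
      (step_steps_le hΨ hν hν' hk (h k List.mem_cons_self) hl' hw)

/-! ### Two functionals -/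

/-- The negative of the (unnormalized) entropy of a weight. -/
def negEntropy (w : Ω → ℝ) : ℝ :=
  ∑ x, w x * Real.log (w x) - (∑ x, w x) * Real.log (∑ x, w x)

/-- The (unnormalized) variance of a sign. -/
def signVar (s : Ω → ℝ) (w : Ω → ℝ) : ℝ :=
  ∑ x, w x - (∑ x, s x * w x) ^ 2 / ∑ x, w x

lemma isRegular_negEntropy : IsRegular (negEntropy (Ω := Ω)) := by
  have hc : Continuous (negEntropy (Ω := Ω)) := by
    unfold negEntropy
    have hs : Continuous fun w : Ω → ℝ => ∑ x, w x := by fun_prop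
    exact (continuous_finsetSum _ fun x _ =>
      Real.continuous_mul_log.comp (continuous_apply x)).sub (Real.continuous_mul_log.comp hs)
  refine ⟨hc.measurable, fun R => ?_⟩
  obtain ⟨K, hK⟩ := (isCompact_univ_pi fun _ : Ω => isCompact_Icc (a := (0 : ℝ)) (b := R)
    ).exists_bound_of_continuousOn hc.continuousOn
  exact ⟨K, fun w h0 hR => hK w fun x _ => ⟨h0 x, hR x⟩⟩

lemma IsSign.abs_sum_le {s : Ω → ℝ} (hs : IsSign s) {w : Ω → ℝ} (hw : ∀ x, 0 ≤ w x) :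
    |∑ x, s x * w x| ≤ ∑ x, w x := by
  refine (Finset.abs_sum_le_sum_abs _ _).trans (Finset.sum_le_sum fun x _ => ?_)
  rcases hs x with h | h <;> simp [h, abs_of_nonneg (hw x)]

/-- The bias of the sign `s` under the weight `w`. -/
def bias (s w : Ω → ℝ) : ℝ := (∑ x, s x * w x) / ∑ x, w x

lemma IsSign.abs_bias_le {s : Ω → ℝ} (hs : IsSign s) {w : Ω → ℝ} (hw : ∀ x, 0 ≤ w x) :
    |bias s w| ≤ 1 := by
  rw [bias, abs_div, abs_of_nonneg (Finset.sum_nonneg fun x _ => hw x)]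
  exact div_le_one_of_le₀ (hs.abs_sum_le hw) (Finset.sum_nonneg fun x _ => hw x)

/-- When the total mass is zero, `bias` takes the default value `0`; the identity survives because
the signed sum vanishes too. -/
lemma sum_mul_bias {s : Ω → ℝ} (hs : IsSign s) {w : Ω → ℝ} (hw : ∀ x, 0 ≤ w x) :
    (∑ x, w x) * bias s w = ∑ x, s x * w x := by
  rcases eq_or_ne (∑ x, w x) 0 with h | h
  · have := hs.abs_sum_le hw
    rw [h] at this
    rw [h, zero_mul, abs_eq_zero.1 (le_antisymm this (abs_nonneg _))]
  · rw [bias, mul_div_cancel₀ _ h]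

lemma signVar_eq {s : Ω → ℝ} (w : Ω → ℝ) :
    signVar s w = (∑ x, w x) * (1 - bias s w ^ 2) := by
  rcases eq_or_ne (∑ x, w x) 0 with h | h
  · simp [signVar, h]
  · rw [signVar, bias]; field_simp

lemma isRegular_signVar {s : Ω → ℝ} (hs : IsSign s) : IsRegular (signVar s) := by
  refine ⟨?_, fun R => ⟨Fintype.card Ω * R, fun w h0 hR => ?_⟩⟩
  · unfold signVar; fun_prop
  · have hW : 0 ≤ ∑ x, w x := Finset.sum_nonneg fun x _ => h0 x
    have hb := sq_le_one_of_abs (hs.abs_bias_le h0)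
    rw [signVar_eq, abs_of_nonneg (mul_nonneg hW (sub_nonneg.2 hb))]
    have : ∑ x, w x ≤ Fintype.card Ω * R := by
      simpa using Finset.sum_le_sum fun x (_ : x ∈ Finset.univ) => hR x
    nlinarith [sq_nonneg (bias s w)]

lemma mul_log_mul (a b : ℝ) :
    a * b * Real.log (a * b) = b * (a * Real.log a) + a * (b * Real.log b) := by
  rcases eq_or_ne a 0 with rfl | ha
  · simp
  rcases eq_or_ne b 0 with rfl | hb
  · simp
  rw [Real.log_mul ha hb]; ring

lemma mul_log_add_mul_log (a m : ℝ) :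
    a * (1 + m) * Real.log (a * (1 + m)) + a * (1 - m) * Real.log (a * (1 - m)) =
      2 * (a * Real.log a) + 2 * (a * deficit m) := by
  rw [mul_log_mul, mul_log_mul, deficit]; ring

lemma sum_tilt (s : Ω → ℝ) (m : ℝ) (w : Ω → ℝ) :
    ∑ x, tilt s m w x = ∑ x, w x + (∑ x, s x * w x) * m := by
  rw [Finset.sum_mul, ← Finset.sum_add_distrib]
  exact Finset.sum_congr rfl fun x _ => by simp only [tilt]; ring

/-- Adding the outcomes `m` and `-m` turns each `w log w` term into a deficit: `d(m)` for each
point, by evenness, and `d(bm)` for the total mass, where `b` is the bias of `s`. -/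
lemma negEntropy_tilt_add {s : Ω → ℝ} (hs : IsSign s) {w : Ω → ℝ} (hw : ∀ x, 0 ≤ w x)
    (m : ℝ) :
    negEntropy (tilt s m w) + negEntropy (tilt s (-m) w) =
      2 * (negEntropy w + (∑ x, w x) * (deficit m - deficit (bias s w * m))) := by
  have h1 : ∑ x, tilt s m w x * Real.log (tilt s m w x) +
      ∑ x, tilt s (-m) w x * Real.log (tilt s (-m) w x) =
      2 * ∑ x, w x * Real.log (w x) + 2 * ((∑ x, w x) * deficit m) := by
    rw [← Finset.sum_add_distrib, Finset.mul_sum, Finset.sum_mul, Finset.mul_sum,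
      ← Finset.sum_add_distrib]
    refine Finset.sum_congr rfl fun x _ => ?_
    have := mul_log_add_mul_log (w x) (s x * m)
    rw [hs.deficit_mul] at this
    simpa only [tilt, mul_neg, ← sub_eq_add_neg] using this
  have h2 : ∀ m, ∑ x, tilt s m w x = (∑ x, w x) * (1 + bias s w * m) := fun m => by
    rw [sum_tilt, ← sum_mul_bias hs hw]; ring
  have h3 := mul_log_add_mul_log (∑ x, w x) (bias s w * m)
  simp only [negEntropy, h2, mul_neg, ← sub_eq_add_neg]
  linarith [h1, h3]

lemma integral_eq_half_add_neg {ν : Measure ℝ} (hν : IsBiasLaw ν) {f : ℝ → ℝ}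
    (hf : Integrable f ν) : ∫ m, f m ∂ν = ∫ m, (f m + f (-m)) / 2 ∂ν := by
  have hmp : MeasurePreserving (fun m : ℝ => -m) ν ν := ⟨measurable_neg, hν.map_neg⟩
  have h1 : ∫ m, f (-m) ∂ν = ∫ m, f m ∂ν :=
    hmp.integral_comp (MeasurableEquiv.neg ℝ).measurableEmbedding f
  have h2 : Integrable (fun m => f (-m)) ν := hmp.integrable_comp_of_integrable hf
  rw [integral_div, integral_add hf h2, h1]; ring

lemma IsBiasLaw.integrable_deficit_mul {ν : Measure ℝ} (hν : IsBiasLaw ν) {b : ℝ}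
    (hb : |b| ≤ 1) : Integrable (fun m => deficit (b * m)) ν := by
  have := hν.isProbabilityMeasure
  refine Integrable.of_bound (measurable_deficit.comp (measurable_const_mul b)
    ).aestronglyMeasurable (Real.log 2) ?_
  filter_upwards [hν.abs_le_one] with m hm
  rw [Real.norm_of_nonneg (deficit_nonneg (abs_mul_le_one hb hm))]
  exact deficit_le_log_two (abs_mul_le_one hb hm)

lemma IsBiasLaw.integrable_deficit {ν : Measure ℝ} (hν : IsBiasLaw ν) :
    Integrable deficit ν := by
  simpa using hν.integrable_deficit_mul (b := 1) (by simp)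

/-- This is `H(Y) - H(Y|X)` for a symmetric channel: given `|m|` it is binary symmetric, its noise
has deficit `d(m)` and its output has deficit `d(bm)`. -/
lemma step_negEntropy {ν : Measure ℝ} (hν : IsBiasLaw ν) {s : Ω → ℝ} (hs : IsSign s)
    {w : Ω → ℝ} (hw : ∀ x, 0 ≤ w x) :
    step ν s negEntropy w =
      negEntropy w + (∑ x, w x) * ∫ m, (deficit m - deficit (bias s w * m)) ∂ν := by
  have := hν.isProbabilityMeasure
  have hi := isRegular_negEntropy.integrable hν hs hw
  have hd : Integrable (fun m => deficit m - deficit (bias s w * m)) ν :=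
    hν.integrable_deficit.sub (hν.integrable_deficit_mul (hs.abs_bias_le hw))
  rw [step, integral_eq_half_add_neg hν hi]
  simp only [negEntropy_tilt_add hs hw, mul_div_cancel_left₀ _ (two_ne_zero' ℝ)]
  rw [integral_add (integrable_const _) (hd.const_mul _), integral_const_mul]
  simp

/-! ### The bias law of the binary erasure channel -/

/-- The law of the bias of the output of the binary erasure channel. -/
def becLaw (t : ℝ) : Measure ℝ :=
  ENNReal.ofReal (1 - t) • Measure.dirac 0 +
    (ENNReal.ofReal (t / 2) • Measure.dirac 1 + ENNReal.ofReal (t / 2) • Measure.dirac (-1))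

lemma integral_becLaw {t : ℝ} (ht : t ∈ Icc (0 : ℝ) 1) (f : ℝ → ℝ) :
    ∫ m, f m ∂(becLaw t) = (1 - t) * f 0 + t / 2 * (f 1 + f (-1)) := by
  have hi : ∀ a : ℝ, Integrable f (Measure.dirac a) := fun a => integrable_dirac (by simp)
  have hi' : ∀ (c a : ℝ), Integrable f (ENNReal.ofReal c • Measure.dirac a) := fun c a =>
    (hi a).smul_measure ENNReal.ofReal_ne_top
  rw [becLaw, integral_add_measure (hi' _ _) ((hi' _ _).add_measure (hi' _ _)),
    integral_add_measure (hi' _ _) (hi' _ _)]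
  simp only [integral_smul_measure, integral_dirac, smul_eq_mul]
  rw [ENNReal.toReal_ofReal (by linarith [ht.2]), ENNReal.toReal_ofReal (by linarith [ht.1])]
  ring

lemma isBiasLaw_becLaw {t : ℝ} (ht : t ∈ Icc (0 : ℝ) 1) : IsBiasLaw (becLaw t) := by
  refine ⟨⟨?_⟩, ?_, ?_⟩
  · simp only [becLaw, Measure.coe_add, Measure.coe_smul, Pi.add_apply, Pi.smul_apply,
      measure_univ, smul_eq_mul, mul_one]
    rw [← ENNReal.ofReal_add (by linarith [ht.1]) (by linarith [ht.1]),
      ← ENNReal.ofReal_add (by linarith [ht.2]) (by linarith [ht.1])]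
    norm_num
  · simp only [becLaw, ae_add_measure_iff]
    refine ⟨?_, ?_, ?_⟩ <;> refine Measure.ae_smul_measure ?_ _ <;> simp [ae_dirac_eq]
  · rw [becLaw, Measure.map_add _ _ measurable_neg, Measure.map_add _ _ measurable_neg]
    simp only [Measure.map_smul, Measure.map_dirac' measurable_neg, neg_zero, neg_neg]
    rw [add_comm (ENNReal.ofReal (t / 2) • Measure.dirac (-1 : ℝ))]

lemma integral_deficit_becLaw {t : ℝ} (ht : t ∈ Icc (0 : ℝ) 1) :
    ∫ m, deficit m ∂(becLaw t) = t * Real.log 2 := by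
  rw [integral_becLaw ht, deficit_neg, deficit_zero, deficit_one]; ring

lemma step_becLaw {α : Type*} {t : ℝ} (ht : t ∈ Icc (0 : ℝ) 1) (s : α → ℝ)
    (Ψ : (α → ℝ) → ℝ) (w : α → ℝ) :
    step (becLaw t) s Ψ w = (1 - t) * Ψ w + t / 2 * (Ψ (tilt s 1 w) + Ψ (tilt s (-1) w)) := by
  rw [step, integral_becLaw ht]
  have : tilt s 0 w = w := by funext x; simp [tilt]
  rw [this]

lemma step_becLaw_negEntropy {t : ℝ} (ht : t ∈ Icc (0 : ℝ) 1) {s : Ω → ℝ} (hs : IsSign s)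
    {w : Ω → ℝ} (hw : ∀ x, 0 ≤ w x) :
    step (becLaw t) s negEntropy w =
      negEntropy w + (∑ x, w x) * (t * (Real.log 2 - deficit (bias s w))) := by
  rw [step_negEntropy (isBiasLaw_becLaw ht) hs hw, integral_becLaw ht]
  simp only [mul_zero, mul_one, mul_neg, deficit_neg, deficit_zero, deficit_one]
  ring

/-- The binary erasure channel is more capable than any BMS channel of no larger capacity. -/
lemma step_negEntropy_le {ν : Measure ℝ} (hν : IsBiasLaw ν) {t : ℝ} (ht : t ∈ Icc (0 : ℝ) 1)
    (hνt : ∫ m, deficit m ∂ν ≤ t * Real.log 2) {s : Ω → ℝ} (hs : IsSign s)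
    {w : Ω → ℝ} (hw : ∀ x, 0 ≤ w x) :
    step ν s negEntropy w ≤ step (becLaw t) s negEntropy w := by
  rw [step_becLaw_negEntropy ht hs hw, step_negEntropy hν hs hw]
  refine add_le_add le_rfl (mul_le_mul_of_nonneg_left ?_ (Finset.sum_nonneg fun x _ => hw x))
  have hb := hs.abs_bias_le hw
  have hl : 0 < Real.log 2 := Real.log_pos one_lt_two
  have hi := hν.integrable_deficit_mul hb
  -- Chebyshev's inequality makes the integrand's bound linear in `deficit m`, so that only the
  -- capacity of the channel enters.
  have h1 : ∫ m, (deficit m - deficit (bias s w * m)) ∂ν ≤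
      ∫ m, (1 - deficit (bias s w) / Real.log 2) * deficit m ∂ν := by
    refine integral_mono_ae (hν.integrable_deficit.sub hi)
      (hν.integrable_deficit.const_mul _) ?_
    filter_upwards [hν.abs_le_one] with m hm
    have h := deficit_mul_deficit_le hb hm
    have : deficit (bias s w) / Real.log 2 * deficit m ≤ deficit (bias s w * m) := by
      rw [div_mul_eq_mul_div, div_le_iff₀ hl]; linarith
    linarith
  rw [integral_const_mul] at h1
  have h2 : 0 ≤ 1 - deficit (bias s w) / Real.log 2 := by
    rw [sub_nonneg, div_le_one hl]; exact deficit_le_log_two hb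
  calc _ ≤ _ := h1
    _ ≤ (1 - deficit (bias s w) / Real.log 2) * (t * Real.log 2) :=
        mul_le_mul_of_nonneg_left hνt h2
    _ = _ := by field_simp

/-- From `d(bm) ≤ b² d(m)`: the yield is at least `(1 - b²) E d(m)` per unit of mass. -/
lemma negEntropy_add_le_step {ν : Measure ℝ} (hν : IsBiasLaw ν) {s : Ω → ℝ} (hs : IsSign s)
    {w : Ω → ℝ} (hw : ∀ x, 0 ≤ w x) :
    negEntropy w + (∫ m, deficit m ∂ν) * signVar s w ≤ step ν s negEntropy w := by
  rw [step_negEntropy hν hs hw, signVar_eq, mul_left_comm]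
  refine add_le_add le_rfl (mul_le_mul_of_nonneg_left ?_ (Finset.sum_nonneg fun x _ => hw x))
  have hb := hs.abs_bias_le hw
  rw [mul_comm, ← integral_const_mul]
  refine integral_mono_ae (hν.integrable_deficit.const_mul _)
    (hν.integrable_deficit.sub (hν.integrable_deficit_mul hb)) ?_
  filter_upwards [hν.abs_le_one] with m hm
  have := deficit_mul_le hb hm
  linarith

end Operators

/-! ### Second moment of the bias -/

lemma IsBiasLaw.integrable_sq {ν : Measure ℝ} (hν : IsBiasLaw ν) :
    Integrable (fun m : ℝ => m ^ 2) ν := by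
  have := hν.isProbabilityMeasure
  refine Integrable.of_bound (by fun_prop) 1 ?_
  filter_upwards [hν.abs_le_one] with m hm
  rw [Real.norm_of_nonneg (sq_nonneg m)]; exact sq_le_one_of_abs hm

lemma IsBiasLaw.integral_sq_le_one {ν : Measure ℝ} (hν : IsBiasLaw ν) :
    ∫ m, m ^ 2 ∂ν ≤ 1 := by
  have := hν.isProbabilityMeasure
  have : ∫ m, m ^ 2 ∂ν ≤ ∫ _, (1 : ℝ) ∂ν := by
    refine integral_mono_ae hν.integrable_sq (integrable_const _) ?_
    filter_upwards [hν.abs_le_one] with m hm using sq_le_one_of_abs hm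
  simpa using this

lemma IsBiasLaw.integral_deficit_le {ν : Measure ℝ} (hν : IsBiasLaw ν) :
    ∫ m, deficit m ∂ν ≤ (∫ m, m ^ 2 ∂ν) * Real.log 2 := by
  rw [← integral_mul_const]
  refine integral_mono_ae hν.integrable_deficit (hν.integrable_sq.mul_const _) ?_
  filter_upwards [hν.abs_le_one] with m hm using deficit_le_sq hm

/-! ### Variance of a sign under observations, and the lower bound -/

section Variance

variable {Ω : Type*}

lemma tilt_neg (s : Ω → ℝ) (m : ℝ) (w : Ω → ℝ) : tilt (-s) m w = tilt s (-m) w := by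
  funext x; simp [tilt]

lemma IsSign.neg {s : Ω → ℝ} (hs : IsSign s) : IsSign (-s) := fun x => by
  rcases hs x with h | h <;> simp [h]

/-- The operators of the erasure channel only see the values of a functional on a class of weights
stable under revealing the signs. -/
lemma steps_becLaw_congr {η : ℝ} (hη : η ∈ Icc (0 : ℝ) 1) {Ψ Θ : (Ω → ℝ) → ℝ}
    {P : (Ω → ℝ) → Prop} {l : List (Ω → ℝ)}
    (hP : ∀ s ∈ l, ∀ w, P w → P (tilt s 1 w) ∧ P (tilt s (-1) w))
    (h : ∀ w, P w → Ψ w = Θ w) {w : Ω → ℝ} (hw : P w) :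
    steps (becLaw η) l Ψ w = steps (becLaw η) l Θ w := by
  induction l generalizing w with
  | nil => exact h w hw
  | cons s l ih =>
    have ih' := fun w (hw : P w) => ih (fun s hs => hP s (List.mem_cons_of_mem _ hs)) hw
    obtain ⟨h1, h2⟩ := hP s List.mem_cons_self w hw
    change step _ s _ w = step _ s _ w
    rw [step_becLaw hη, step_becLaw hη]
    change _ * steps _ l Ψ w + _ * (steps _ l Ψ _ + steps _ l Ψ _) =
      _ * steps _ l Θ w + _ * (steps _ l Θ _ + steps _ l Θ _)
    rw [ih' _ hw, ih' _ h1, ih' _ h2]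

variable [Fintype Ω]

lemma signVar_smul (s : Ω → ℝ) (c : ℝ) (w : Ω → ℝ) :
    signVar s (fun x => c * w x) = c * signVar s w := by
  have h1 : ∑ x, s x * (c * w x) = c * ∑ x, s x * w x := by
    rw [Finset.mul_sum]; exact Finset.sum_congr rfl fun x _ => by ring
  rw [signVar, signVar, h1, ← Finset.mul_sum]
  rcases eq_or_ne c 0 with rfl | hc
  · simp
  · rw [mul_pow, pow_two c, mul_assoc, mul_div_mul_left _ _ hc]; ring

lemma sum_mul_tilt (s s' : Ω → ℝ) (m : ℝ) (w : Ω → ℝ) :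
    ∑ x, s x * tilt s' m w x = ∑ x, s x * w x + (∑ x, s x * s' x * w x) * m := by
  rw [Finset.sum_mul, ← Finset.sum_add_distrib]
  exact Finset.sum_congr rfl fun x _ => by simp only [tilt]; ring

lemma signVar_tilt (s s' : Ω → ℝ) (m : ℝ) (w : Ω → ℝ) :
    signVar s (tilt s' m w) = (∑ x, w x + (∑ x, s' x * w x) * m) -
      (∑ x, s x * w x + (∑ x, s x * s' x * w x) * m) ^ 2 /
        (∑ x, w x + (∑ x, s' x * w x) * m) := by
  rw [signVar, sum_tilt, sum_mul_tilt]

/-- Equality forces `s = 1` on the support of `w`, so observing `s` only rescales. -/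
lemma tilt_eq_of_sum_eq {s : Ω → ℝ} (hs : IsSign s) {w : Ω → ℝ} (hw : ∀ x, 0 ≤ w x)
    (h : ∑ x, s x * w x = ∑ x, w x) (m : ℝ) : tilt s m w = fun x => (1 + m) * w x := by
  have hle : ∀ x ∈ Finset.univ, s x * w x ≤ w x := fun x _ => by
    rcases hs x with h | h <;> rw [h] <;> linarith [hw x]
  have heq := (Finset.sum_eq_sum_iff_of_le hle).1 h
  funext x
  have := heq x (Finset.mem_univ x)
  rw [tilt]
  linear_combination m * this

/-- The left side equals `2A²/T` plus `m²` times a function increasing in `m²`. It therefore lies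
below the chord, in the variable `m²`, joining its values at `m = 0` and `m = 1`. -/
lemma sq_div_add_sq_div_le {T A B c m : ℝ} (hc : |c| < T) (hm : |m| ≤ 1) :
    (A + B * m) ^ 2 / (T + c * m) + (A - B * m) ^ 2 / (T - c * m) ≤
      2 * (1 - m ^ 2) * (A ^ 2 / T) +
        m ^ 2 * ((A + B) ^ 2 / (T + c) + (A - B) ^ 2 / (T - c)) := by
  obtain ⟨hc1, hc2⟩ := abs_lt.1 hc
  have hT : 0 < T := by linarith [abs_nonneg c]
  have key : ∀ m : ℝ, |m| ≤ 1 → 0 < T ^ 2 - m ^ 2 * c ^ 2 ∧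
      (A + B * m) ^ 2 / (T + c * m) + (A - B * m) ^ 2 / (T - c * m) =
      2 * (A ^ 2 / T) + 2 * m ^ 2 * ((T * B - c * A) ^ 2 / T) / (T ^ 2 - m ^ 2 * c ^ 2) := by
    intro m hm
    have hcm : |c * m| < T := by
      rw [abs_mul]; nlinarith [abs_nonneg c, abs_nonneg m]
    obtain ⟨h1, h2⟩ := abs_lt.1 hcm
    have h3 : T + c * m ≠ 0 := by linarith
    have h4 : T - c * m ≠ 0 := by linarith
    have h5 : T ^ 2 - m ^ 2 * c ^ 2 = (T + c * m) * (T - c * m) := by ring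
    refine ⟨by rw [h5]; exact mul_pos (by linarith) (by linarith), ?_⟩
    rw [h5, div_add_div _ _ h3 h4, div_eq_iff (mul_ne_zero h3 h4),
      add_mul (2 * (A ^ 2 / T)), div_mul_cancel₀ _ (mul_ne_zero h3 h4)]
    field_simp
    ring
  obtain ⟨p1, e1⟩ := key m hm
  obtain ⟨p2, e2⟩ := key 1 (by simp)
  simp only [mul_one, one_pow, one_mul] at p2 e2
  rw [e1, e2]
  have hE : 0 ≤ 2 * m ^ 2 * ((T * B - c * A) ^ 2 / T) := by positivity
  have hle : 2 * m ^ 2 * ((T * B - c * A) ^ 2 / T) / (T ^ 2 - m ^ 2 * c ^ 2) ≤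
      2 * m ^ 2 * ((T * B - c * A) ^ 2 / T) / (T ^ 2 - c ^ 2) := by
    refine div_le_div_of_nonneg_left hE p2 ?_
    nlinarith [sq_le_one_of_abs hm, sq_nonneg c]
  calc _ ≤ _ := add_le_add_right hle _
    _ = _ := by ring

lemma signVar_tilt_add_ge {s s' : Ω → ℝ} (hs' : IsSign s') {w : Ω → ℝ} (hw : ∀ x, 0 ≤ w x)
    {m : ℝ} (hm : |m| ≤ 1) :
    2 * (1 - m ^ 2) * signVar s w + m ^ 2 * (signVar s (tilt s' 1 w) + signVar s (tilt s' (-1) w))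
      ≤ signVar s (tilt s' m w) + signVar s (tilt s' (-m) w) := by
  -- If `s'` is deterministic under `w`, one of the fully revealed weights has zero mass and the
  -- fractions degenerate; tilting is then mere rescaling.
  rcases (hs'.abs_sum_le hw).lt_or_eq with hlt | heq
  · have := sq_div_add_sq_div_le (A := ∑ x, s x * w x) (B := ∑ x, s x * s' x * w x) hlt hm
    simp only [signVar_tilt, mul_one, mul_neg, ← sub_eq_add_neg]
    rw [signVar]
    linarith
  · have hW : 0 ≤ ∑ x, w x := Finset.sum_nonneg fun x _ => hw x
    rcases (abs_eq hW).1 heq with h | h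
    · simp only [tilt_eq_of_sum_eq hs' hw h, signVar_smul]
      linarith
    · have h' : ∑ x, (-s') x * w x = ∑ x, w x := by
        simp only [Pi.neg_apply, neg_mul, Finset.sum_neg_distrib, h, neg_neg]
      have e : ∀ m, tilt s' m w = fun x => (1 - m) * w x := fun m => by
        rw [← neg_neg s', tilt_neg, tilt_eq_of_sum_eq hs'.neg hw h', sub_eq_add_neg]
      simp only [e, signVar_smul]
      linarith

/-- The binary erasure channel with the same second moment of the bias is less noisy, tested
against the variance of a sign. -/
lemma step_becLaw_signVar_le {ν : Measure ℝ} (hν : IsBiasLaw ν) {η : ℝ}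
    (hη : η ∈ Icc (0 : ℝ) 1) (hνη : ∫ m, m ^ 2 ∂ν = η) {s s' : Ω → ℝ} (hs : IsSign s)
    (hs' : IsSign s') {w : Ω → ℝ} (hw : ∀ x, 0 ≤ w x) :
    step (becLaw η) s' (signVar s) w ≤ step ν s' (signVar s) w := by
  have := hν.isProbabilityMeasure
  have hi := (isRegular_signVar hs).integrable hν hs' hw
  have hi' : Integrable (fun m => signVar s (tilt s' (-m) w)) ν :=
    (⟨measurable_neg, hν.map_neg⟩ : MeasurePreserving (fun m : ℝ => -m) ν ν
      ).integrable_comp_of_integrable hi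
  have hsq := hν.integrable_sq
  rw [step_becLaw hη, step, integral_eq_half_add_neg hν hi]
  set D := (signVar s (tilt s' 1 w) + signVar s (tilt s' (-1) w)) / 2 - signVar s w with hD
  have h1 : ∫ m, (signVar s w + m ^ 2 * D) ∂ν = signVar s w + η * D := by
    rw [integral_add (integrable_const _) (hsq.mul_const D), integral_mul_const, hνη]
    simp
  calc _ = signVar s w + η * D := by rw [hD]; ring
    _ = ∫ m, (signVar s w + m ^ 2 * D) ∂ν := h1.symm
    _ ≤ _ := by
      refine integral_mono_ae ((integrable_const _).add (hsq.mul_const D))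
        ((hi.add hi').div_const 2) ?_
      filter_upwards [hν.abs_le_one] with m hm
      have := signVar_tilt_add_ge (s := s) hs' hw hm
      rw [hD]
      linarith

/-- Lower bound on the information of a BMS channel in terms of that of an erasure channel, for
weights under which all signs stay either deterministic or uniform when signs are revealed. -/
lemma mul_steps_becLaw_sub_le {ν : Measure ℝ} (hν : IsBiasLaw ν) {η : ℝ}
    (hη : η ∈ Icc (0 : ℝ) 1) (hη0 : 0 < η) (hνη : ∫ m, m ^ 2 ∂ν = η)
    {P : (Ω → ℝ) → Prop} {l : List (Ω → ℝ)} (hl : ∀ s ∈ l, IsSign s)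
    (hP0 : ∀ w, P w → ∀ x, 0 ≤ w x)
    (hP : ∀ s ∈ l, ∀ w, P w → P (tilt s 1 w) ∧ P (tilt s (-1) w))
    (hPb : ∀ s ∈ l, ∀ w, P w → bias s w = 0 ∨ bias s w ^ 2 = 1) {w : Ω → ℝ} (hw : P w) :
    (∫ m, deficit m ∂ν) / (η * Real.log 2) *
        (steps (becLaw η) l negEntropy w - negEntropy w) ≤
      steps ν l negEntropy w - negEntropy w := by
  have hl2 : 0 < Real.log 2 := Real.log_pos one_lt_two
  have hνp := hν.isProbabilityMeasure
  set I := ∫ m, deficit m ∂ν with hI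
  have hI0 : 0 ≤ I := integral_nonneg_of_ae (by
    filter_upwards [hν.abs_le_one] with m hm using deficit_nonneg hm)
  have hbec := isBiasLaw_becLaw hη
  -- Chain rule: the last sign is observed innermost, hence on the posterior left by all the others.
  induction l using List.reverseRecOn with
  | nil => simp [steps]
  | append_singleton l s ih =>
    have hl' : ∀ s ∈ l, IsSign s := fun s hs => hl s (List.mem_append_left _ hs)
    have hs := hl s (List.mem_append_right _ List.mem_cons_self)
    have hPl : ∀ s ∈ l, ∀ w, P w → P (tilt s 1 w) ∧ P (tilt s (-1) w) :=
      fun s hs => hP s (List.mem_append_left _ hs)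
    have ih := ih hl' hPl (fun s hs => hPb s (List.mem_append_left _ hs))
    have hV := isRegular_signVar hs
    have hw0 := hP0 w hw
    have h1 : steps ν l negEntropy w + I * steps ν l (signVar s) w ≤
        steps ν (l ++ [s]) negEntropy w := by
      rw [steps_concat, ← steps_const_mul, ← steps_add isRegular_negEntropy (hV.const_mul I) hν
        hl' hw0]
      exact steps_mono (isRegular_negEntropy.add (hV.const_mul I))
        (isRegular_negEntropy.step hν hs) hν hl'
        (fun w hw => negEntropy_add_le_step hν hs hw) hw0
    have h2 : steps (becLaw η) l (signVar s) w ≤ steps ν l (signVar s) w :=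
      steps_le_steps hV hbec hν hl'
        (fun s' hs' w hw => step_becLaw_signVar_le hν hη hνη hs (hl' s' hs') hw) hw0
    -- For erasures the variance bound is an equality: along the class `P` the bias is `0` or `±1`,
    -- exactly where `d(b) = b² log 2`.
    have h3 : steps (becLaw η) (l ++ [s]) negEntropy w =
        steps (becLaw η) l negEntropy w +
          η * Real.log 2 * steps (becLaw η) l (signVar s) w := by
      rw [steps_concat, ← steps_const_mul, ← steps_add isRegular_negEntropy
        (hV.const_mul _) hbec hl' hw0]
      refine steps_becLaw_congr hη hPl (fun w hw => ?_) hw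
      rw [step_becLaw_negEntropy hη hs (hP0 w hw), signVar_eq]
      rcases hPb s (List.mem_append_right _ List.mem_cons_self) w hw with h | h
      · rw [h, deficit_zero]; ring
      · have : deficit (bias s w) = Real.log 2 := by
          rcases (mul_self_eq_one_iff.1 ((pow_two _).symm.trans h)) with h | h
          · rw [h, deficit_one]
          · rw [h, deficit_neg, deficit_one]
        rw [this, h]; ring
    rw [h3]
    have h4 : I / (η * Real.log 2) * (η * Real.log 2 * steps (becLaw η) l (signVar s) w) =
        I * steps (becLaw η) l (signVar s) w := by
      field_simp
    have h5 := mul_le_mul_of_nonneg_left h2 hI0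
    rw [add_sub_right_comm, mul_add, h4]
    linarith

lemma steps_negEntropy_le {ν : Measure ℝ} (hν : IsBiasLaw ν) {t : ℝ} (ht : t ∈ Icc (0 : ℝ) 1)
    (hνt : ∫ m, deficit m ∂ν ≤ t * Real.log 2) {l : List (Ω → ℝ)} (hl : ∀ s ∈ l, IsSign s)
    {w : Ω → ℝ} (hw : ∀ x, 0 ≤ w x) :
    steps ν l negEntropy w ≤ steps (becLaw t) l negEntropy w :=
  steps_le_steps isRegular_negEntropy hν (isBiasLaw_becLaw ht) hl
    (fun _ hs _ hw => step_negEntropy_le hν ht hνt (hl _ hs) hw) hw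

/-- The main comparison: `w` as in `mul_steps_becLaw_sub_le`, and the erasure channel has the
same capacity. -/
lemma mul_steps_becLaw_sub_le_of_capacity {ν : Measure ℝ} (hν : IsBiasLaw ν) {t : ℝ}
    (ht0 : 0 < t) (hνt : ∫ m, deficit m ∂ν = t * Real.log 2)
    {P : (Ω → ℝ) → Prop} {l : List (Ω → ℝ)} (hl : ∀ s ∈ l, IsSign s)
    (hP0 : ∀ w, P w → ∀ x, 0 ≤ w x)
    (hP : ∀ s ∈ l, ∀ w, P w → P (tilt s 1 w) ∧ P (tilt s (-1) w))
    (hPb : ∀ s ∈ l, ∀ w, P w → bias s w = 0 ∨ bias s w ^ 2 = 1) {w : Ω → ℝ} (hw : P w) :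
    t / (∫ m, m ^ 2 ∂ν) * (steps (becLaw t) l negEntropy w - negEntropy w) ≤
      steps ν l negEntropy w - negEntropy w := by
  have hl2 : 0 < Real.log 2 := Real.log_pos one_lt_two
  have := hν.isProbabilityMeasure
  set η := ∫ m, m ^ 2 ∂ν with hηdef
  have htη : t ≤ η := le_of_mul_le_mul_right (hνt ▸ hν.integral_deficit_le) hl2
  have hη1 : η ≤ 1 := hν.integral_sq_le_one
  have hη0 : 0 < η := ht0.trans_le htη
  have hη : η ∈ Icc (0 : ℝ) 1 := ⟨hη0.le, hη1⟩
  have ht : t ∈ Icc (0 : ℝ) 1 := ⟨ht0.le, htη.trans hη1⟩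
  have h1 := mul_steps_becLaw_sub_le hν hη hη0 hηdef.symm hl hP0 hP hPb hw
  rw [hνt, mul_div_mul_right _ _ hl2.ne'] at h1
  -- The upper bound, applied with the erasure channel of parameter `t` as the symmetric channel.
  have h2 : steps (becLaw t) l negEntropy w ≤ steps (becLaw η) l negEntropy w :=
    steps_negEntropy_le (isBiasLaw_becLaw ht) hη
      (by rw [integral_deficit_becLaw ht]; exact mul_le_mul_of_nonneg_right htη hl2.le) hl
      (hP0 w hw)
  exact (mul_le_mul_of_nonneg_left (sub_le_sub_right h2 _) (div_nonneg ht0.le hη0.le)).trans h1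

end Variance

/-! ### Mutual information of a channel given by densities -/

section Densities

variable {Ω : Type*} [Fintype Ω]

/-- The contribution of a single output to the divergence. The linear part `1 - u` of `klFun`
averages to zero, leaving posterior minus prior. -/
lemma sum_mul_klFun_div {p g : Ω → ℝ} (hp : ∀ x, 0 ≤ p x) (hp1 : ∑ x, p x = 1)
    (hg : ∀ x, 0 ≤ g x) :
    ∑ x, p x * ((∑ x, p x * g x) *
        InformationTheory.klFun (g x / ∑ x, p x * g x)) =
      negEntropy (fun x => p x * g x) - ∑ x, p x * Real.log (p x) * g x := by
  set Z := ∑ x, p x * g x with hZ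
  rcases eq_or_ne Z 0 with h0 | h0
  · have hz : ∀ x, p x * g x = 0 := fun x =>
      (Finset.sum_eq_zero_iff_of_nonneg fun x _ => mul_nonneg (hp x) (hg x)).1 (hZ ▸ h0) x
        (Finset.mem_univ x)
    have : ∀ x, p x * Real.log (p x) * g x = 0 := fun x => by
      rw [mul_right_comm, hz, zero_mul]
    simp [h0, negEntropy, hz, this]
  · have hterm : ∀ x, p x * (Z * InformationTheory.klFun (g x / Z)) =
        p x * g x * Real.log (p x * g x) - p x * Real.log (p x) * g x -
          p x * g x * Real.log Z + (p x * Z - p x * g x) := by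
      intro x
      rcases eq_or_ne (p x) 0 with hpx | hpx
      · simp [hpx]
      rcases eq_or_ne (g x) 0 with hgx | hgx
      · simp [hgx, InformationTheory.klFun]
      rw [InformationTheory.klFun, Real.log_div hgx h0, Real.log_mul hpx hgx]
      field_simp
      ring
    simp only [hterm, Finset.sum_add_distrib, Finset.sum_sub_distrib, ← Finset.sum_mul, hp1,
      negEntropy, ← hZ]
    ring

variable [MeasurableSpace Ω] [MeasurableSingletonClass Ω]

lemma sum_real_singleton (P : Measure Ω) [IsProbabilityMeasure P] :
    ∑ x, P.real {x} = 1 := by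
  rw [sum_measureReal_singleton]; simp

/-- Relative to `P × μ` the joint law has density `g` and the product of its marginals has density
`Z = ∑ p g`. The divergence is thus an integral over outputs, and `∫ g = 1` turns its last term into
the prior entropy. -/
lemma channelInfo_eq_of_density {𝒵 : Type*} [MeasurableSpace 𝒵] (P : Measure Ω)
    [IsProbabilityMeasure P] (μ : Measure 𝒵) [IsProbabilityMeasure μ] (K : Kernel Ω 𝒵)
    [IsMarkovKernel K] {g : Ω → 𝒵 → ℝ} (hgm : ∀ x, Measurable (g x)) (hg0 : ∀ x y, 0 ≤ g x y)
    {R : ℝ} (hgR : ∀ x y, g x y ≤ R)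
    (hK : ∀ x, K x = μ.withDensity fun y => ENNReal.ofReal (g x y)) :
    channelInfo P K = ENNReal.ofReal ((∫ y, negEntropy (fun x => P.real {x} * g x y) ∂μ -
      negEntropy fun x => P.real {x}) / Real.log 2) := by
  set p : Ω → ℝ := fun x => P.real {x} with hp
  have hp0 : ∀ x, 0 ≤ p x := fun x => measureReal_nonneg
  have hp1 : ∑ x, p x = 1 := sum_real_singleton P
  set Z : 𝒵 → ℝ := fun y => ∑ x, p x * g x y with hZ
  have hZ0 : ∀ y, 0 ≤ Z y := fun y => Finset.sum_nonneg fun x _ => mul_nonneg (hp0 x) (hg0 x y)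
  have hZz : ∀ y, Z y = 0 → ∀ x, p x * g x y = 0 := fun y h x =>
    (Finset.sum_eq_zero_iff_of_nonneg fun x _ => mul_nonneg (hp0 x) (hg0 x y)).1 h x
      (Finset.mem_univ x)
  have hZm : Measurable Z := by
    rw [hZ]; exact Finset.measurable_sum _ fun x _ => (hgm x).const_mul _
  have hgu : Measurable fun z : Ω × 𝒵 => g z.1 z.2 := measurable_from_prod_countable_right hgm
  have hG : Measurable fun z : Ω × 𝒵 => ENNReal.ofReal (g z.1 z.2) := hgu.ennreal_ofReal
  have hlin : ∀ f : Ω → ℝ, (∀ x, 0 ≤ f x) →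
      ∫⁻ x, ENNReal.ofReal (f x) ∂P = ENNReal.ofReal (∑ x, p x * f x) := by
    intro f hf
    rw [lintegral_fintype, ENNReal.ofReal_sum_of_nonneg fun x _ => mul_nonneg (hp0 x) (hf x)]
    refine Finset.sum_congr rfl fun x _ => ?_
    rw [mul_comm (p x), ENNReal.ofReal_mul (hf x), hp, ofReal_measureReal]
  have hKd : K = Kernel.withDensity (Kernel.const Ω μ) fun x y => ENNReal.ofReal (g x y) := by
    ext1 x
    rw [Kernel.withDensity_apply _ hG, hK, Kernel.const_apply]
  have hρ : P ⊗ₘ K = (P.prod μ).withDensity fun z => ENNReal.ofReal (g z.1 z.2) := by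
    have hsf : IsSFiniteKernel
        (Kernel.withDensity (Kernel.const Ω μ) fun x y => ENNReal.ofReal (g x y)) := by
      rw [← hKd]; infer_instance
    rw [hKd, Measure.compProd_withDensity hG, Measure.compProd_const]
  have hsnd : (P ⊗ₘ K).snd = μ.withDensity fun y => ENNReal.ofReal (Z y) := by
    rw [Measure.snd_compProd]
    ext B hB
    rw [Measure.bind_apply hB K.aemeasurable, withDensity_apply _ hB]
    simp only [hK, withDensity_apply _ hB]
    rw [lintegral_lintegral_swap hG.aemeasurable]
    exact lintegral_congr fun y => hlin (fun x => g x y) fun x => hg0 x y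
  have hfst : (P ⊗ₘ K).fst = P := Measure.fst_compProd P K
  have hσ : P.prod (P ⊗ₘ K).snd =
      (P.prod μ).withDensity fun z => ENNReal.ofReal (Z z.2) := by
    rw [hsnd, prod_withDensity_right hZm.ennreal_ofReal]
  have hprob : IsProbabilityMeasure (P ⊗ₘ K).snd := by infer_instance
  have hfm : Measurable fun z : Ω × 𝒵 => ENNReal.ofReal (g z.1 z.2 / Z z.2) :=
    (hgu.div (hZm.comp measurable_snd)).ennreal_ofReal
  have hZm2 : Measurable fun z : Ω × 𝒵 => ENNReal.ofReal (Z z.2) :=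
    (hZm.comp measurable_snd).ennreal_ofReal
  have hρσ : P ⊗ₘ K = (P.prod (P ⊗ₘ K).snd).withDensity
      fun z => ENNReal.ofReal (g z.1 z.2 / Z z.2) := by
    rw [hσ, ← withDensity_mul _ hZm2 hfm, hρ]
    refine withDensity_congr_ae ?_
    -- Where `Z = 0` the quotient `g / Z` is `0` by convention. This is harmless: `p g = 0` there
    -- and `p ≠ 0` almost surely, so `g = 0`.
    have hae : ∀ᵐ x ∂P, p x ≠ 0 := by
      rw [ae_iff_of_countable]
      intro x hx
      exact (measureReal_ne_zero_iff).2 hx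
    have hae' : ∀ᵐ z ∂(P.prod μ), p z.1 ≠ 0 := Measure.quasiMeasurePreserving_fst.ae hae
    filter_upwards [hae'] with z hz
    rw [Pi.mul_apply, ← ENNReal.ofReal_mul (hZ0 _)]
    rcases eq_or_ne (Z z.2) 0 with h0 | h0
    · rw [(mul_eq_zero.1 (hZz z.2 h0 z.1)).resolve_left hz, zero_div, mul_zero]
    · rw [mul_div_cancel₀ _ h0]
  have hac : P ⊗ₘ K ≪ P.prod (P ⊗ₘ K).snd := by
    have := withDensity_absolutelyContinuous (P.prod (P ⊗ₘ K).snd)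
      fun z => ENNReal.ofReal (g z.1 z.2 / Z z.2)
    rwa [← hρσ] at this
  have hrn : (P ⊗ₘ K).rnDeriv (P.prod (P ⊗ₘ K).snd) =ᵐ[P.prod (P ⊗ₘ K).snd]
      fun z => ENNReal.ofReal (g z.1 z.2 / Z z.2) := by
    have := Measure.rnDeriv_withDensity (P.prod (P ⊗ₘ K).snd) hfm
    rwa [← hρσ] at this
  have hint : ∀ x, ∫ y, g x y ∂μ = 1 := by
    intro x
    have h1 : K x univ = 1 := measure_univ
    rw [hK, withDensity_apply _ MeasurableSet.univ, Measure.restrict_univ] at h1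
    rw [integral_eq_lintegral_of_nonneg_ae (ae_of_all _ (hg0 x)) (hgm x).aestronglyMeasurable, h1,
      ENNReal.toReal_one]
  have hgi : ∀ x, Integrable (g x) μ := fun x =>
    Integrable.of_bound (hgm x).aestronglyMeasurable R (ae_of_all _ fun y => by
      rw [Real.norm_of_nonneg (hg0 x y)]; exact hgR x y)
  have hNm : Measurable fun y => negEntropy fun x => p x * g x y :=
    isRegular_negEntropy.measurable.comp
      (measurable_pi_lambda _ fun x => (hgm x).const_mul (p x))
  have hNi : Integrable (fun y => negEntropy fun x => p x * g x y) μ := by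
    obtain ⟨C, hC⟩ := (isRegular_negEntropy (Ω := Ω)).bounded R
    refine Integrable.of_bound hNm.aestronglyMeasurable C (ae_of_all _ fun y => ?_)
    refine hC _ (fun x => mul_nonneg (hp0 x) (hg0 x y)) fun x => ?_
    have : p x ≤ 1 := measureReal_le_one
    nlinarith [hg0 x y, hgR x y]
  have hLi : ∀ x, Integrable (fun y => p x * Real.log (p x) * g x y) μ := fun x =>
    (hgi x).const_mul _
  rw [channelInfo, mutualInfo, hfst, ENNReal.ofReal_div_of_pos (Real.log_pos one_lt_two)]
  congr 1
  rw [InformationTheory.klDiv_eq_lintegral_klFun_of_ac hac]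
  have hkm : Measurable fun z : Ω × 𝒵 => InformationTheory.klFun (g z.1 z.2 / Z z.2) :=
    InformationTheory.measurable_klFun.comp (hgu.div (hZm.comp measurable_snd))
  have hZkm : Measurable fun z : Ω × 𝒵 =>
      ENNReal.ofReal (Z z.2 * InformationTheory.klFun (g z.1 z.2 / Z z.2)) :=
    ((hZm.comp measurable_snd).mul hkm).ennreal_ofReal
  calc ∫⁻ z, ENNReal.ofReal (InformationTheory.klFun
        ((P ⊗ₘ K).rnDeriv (P.prod (P ⊗ₘ K).snd) z).toReal) ∂(P.prod (P ⊗ₘ K).snd)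
      = ∫⁻ z, ENNReal.ofReal (InformationTheory.klFun (g z.1 z.2 / Z z.2))
          ∂(P.prod (P ⊗ₘ K).snd) := by
        refine lintegral_congr_ae ?_
        filter_upwards [hrn] with z hz
        rw [hz, ENNReal.toReal_ofReal (div_nonneg (hg0 _ _) (hZ0 _))]
    _ = ∫⁻ z, ENNReal.ofReal (Z z.2 * InformationTheory.klFun (g z.1 z.2 / Z z.2))
          ∂(P.prod μ) := by
        rw [hσ, lintegral_withDensity_eq_lintegral_mul _ hZm2
          hkm.ennreal_ofReal]
        exact lintegral_congr fun z => by rw [Pi.mul_apply, ← ENNReal.ofReal_mul (hZ0 _)]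
    _ = ∫⁻ y, ENNReal.ofReal ((negEntropy fun x => p x * g x y) -
          ∑ x, p x * Real.log (p x) * g x y) ∂μ := by
        rw [lintegral_prod_symm' _ hZkm]
        refine lintegral_congr fun y => ?_
        rw [hlin (fun x => Z y * InformationTheory.klFun (g x y / Z y)) fun x =>
          mul_nonneg (hZ0 y) (InformationTheory.klFun_nonneg (div_nonneg (hg0 _ _) (hZ0 _)))]
        rw [← sum_mul_klFun_div hp0 hp1 fun x => hg0 x y]
    _ = ENNReal.ofReal (∫ y, ((negEntropy fun x => p x * g x y) -
          ∑ x, p x * Real.log (p x) * g x y) ∂μ) := by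
        refine (ofReal_integral_eq_lintegral_ofReal
          (hNi.sub (integrable_finsetSum _ fun x _ => hLi x)) (ae_of_all _ fun y => ?_)).symm
        change 0 ≤ (negEntropy fun x => p x * g x y) - ∑ x, p x * Real.log (p x) * g x y
        rw [← sum_mul_klFun_div hp0 hp1 fun x => hg0 x y]
        exact Finset.sum_nonneg fun x _ => mul_nonneg (hp0 x) (mul_nonneg (hZ0 y)
          (InformationTheory.klFun_nonneg (div_nonneg (hg0 _ _) (hZ0 _))))
    _ = _ := by
        rw [integral_sub hNi (integrable_finsetSum _ fun x _ => hLi x),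
          integral_finsetSum _ fun x _ => hLi x]
        simp only [integral_const_mul, hint, mul_one]
        congr 2
        simp [negEntropy, hp1]

end Densities

/-! ### Product densities and iterated observations -/

section Memoryless

variable {Ω 𝒴 : Type*} [MeasurableSpace 𝒴]

lemma pi_withDensity {n : ℕ} (μ : Measure 𝒴) [IsProbabilityMeasure μ] {f : Fin n → 𝒴 → ℝ≥0∞}
    (hf : ∀ i, Measurable (f i)) [∀ i, SigmaFinite (μ.withDensity (f i))] :
    Measure.pi (fun i => μ.withDensity (f i)) =
      (Measure.pi fun _ : Fin n => μ).withDensity fun y => ∏ i, f i (y i) := by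
  refine (Measure.pi_eq (μ := fun i => μ.withDensity (f i)) fun s hs => ?_)
  have hm : ∀ i, Measurable ((s i).indicator (f i)) := fun i => (hf i).indicator (hs i)
  have hind := iIndepFun_pi (μ := fun _ : Fin n => μ) (X := fun i => (s i).indicator (f i))
    fun i => (hm i).aemeasurable
  have h1 := lintegral_prod_eq_prod_lintegral_of_indepFun Finset.univ
    (fun (i : Fin n) (y : Fin n → 𝒴) => (s i).indicator (f i) (y i)) hind
    fun i => (hm i).comp (measurable_pi_apply i)
  rw [withDensity_apply _ (MeasurableSet.univ_pi hs),
    ← lintegral_indicator (MeasurableSet.univ_pi hs)]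
  calc _ = ∫⁻ y, ∏ i, (s i).indicator (f i) (y i) ∂(Measure.pi fun _ : Fin n => μ) := by
        refine lintegral_congr fun y => ?_
        by_cases hy : y ∈ univ.pi s
        · rw [indicator_of_mem hy]
          exact Finset.prod_congr rfl fun i _ => (indicator_of_mem (hy i (mem_univ i)) _).symm
        · rw [indicator_of_notMem hy]
          obtain ⟨i, hi⟩ : ∃ i, y i ∉ s i := by simpa [mem_univ_pi] using hy
          exact (Finset.prod_eq_zero (Finset.mem_univ i) (indicator_of_notMem hi _)).symm
    _ = ∏ i, ∫⁻ y, (s i).indicator (f i) (y i) ∂(Measure.pi fun _ : Fin n => μ) := h1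
    _ = _ := by
        refine Finset.prod_congr rfl fun i _ => ?_
        rw [(measurePreserving_eval (fun _ : Fin n => μ) i).lintegral_comp (hm i),
          lintegral_indicator (hs i), withDensity_apply _ (hs i)]

/-- Averaging over the output of a memoryless channel is the same as averaging over its outputs
one by one. -/
lemma integral_pi_eq_steps [Fintype Ω] (μ : Measure 𝒴) [IsProbabilityMeasure μ] {m : 𝒴 → ℝ}
    (hm : Measurable m) (hm1 : ∀ y, |m y| ≤ 1)
    (hν : IsBiasLaw (μ.map m)) {Ψ : (Ω → ℝ) → ℝ} (hΨ : IsRegular Ψ) {n : ℕ}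
    {s : Fin n → Ω → ℝ} (hs : ∀ i, IsSign (s i)) {w : Ω → ℝ} (hw : ∀ x, 0 ≤ w x) :
    ∫ y, Ψ (fun x => w x * ∏ i, (1 + s i x * m (y i))) ∂(Measure.pi fun _ : Fin n => μ) =
      steps (μ.map m) (List.ofFn s) Ψ w := by
  induction n generalizing w with
  | zero => simp [steps]
  | succ n ih =>
    have hmp := (measurePreserving_piFinSuccAbove (fun _ : Fin (n + 1) => μ) 0).symm
    rw [← hmp.integral_comp']
    simp_rw [MeasurableEquiv.piFinSuccAbove_symm_apply, Fin.insertNthEquiv, Fin.prod_univ_succ,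
      Fin.insertNth_zero]
    simp only [Equiv.coe_fn_mk, Fin.cons_succ, cast_eq, Fin.cons_zero,
      ← mul_assoc]
    rw [integral_prod]
    · rw [List.ofFn_succ]
      change _ = step _ (s 0) (steps _ _ Ψ) w
      rw [step, integral_map hm.aemeasurable]
      · refine integral_congr_ae (ae_of_all _ fun y => ?_)
        exact ih (fun i => hs i.succ) (tilt_nonneg (hs 0) (hm1 y) hw)
      · have hl : ∀ t ∈ List.ofFn (fun i : Fin n => s i.succ), IsSign t := by
          intro t ht
          obtain ⟨i, rfl⟩ := List.mem_ofFn.1 ht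
          exact hs i.succ
        exact ((hΨ.steps hν hl).measurable.comp
          (measurable_tilt_left (s 0) w)).aestronglyMeasurable
    · obtain ⟨R, hR⟩ := exists_upper w
      obtain ⟨K, hK⟩ := hΨ.bounded (2 * R * 2 ^ n)
      have h0 : ∀ (i : Fin n) (x : Ω) (y : 𝒴), 0 ≤ 1 + s i.succ x * m y := fun i x y => by
        linarith [(abs_le.1 ((hs i.succ).abs_mul_le (hm1 y) x)).1]
      have h2 : ∀ (i : Fin n) (x : Ω) (y : 𝒴), 1 + s i.succ x * m y ≤ 2 := fun i x y => by
        linarith [(abs_le.1 ((hs i.succ).abs_mul_le (hm1 y) x)).2]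
      refine Integrable.of_bound (C := K) (hΨ.measurable.comp
        (measurable_pi_lambda _ fun x => ?_)).aestronglyMeasurable (ae_of_all _ fun z => ?_)
      · fun_prop
      · have ht0 := tilt_nonneg (hs 0) (hm1 z.1) hw
        have ht1 := tilt_le (hs 0) (hm1 z.1) hw hR
        refine hK _ (fun x => mul_nonneg (ht0 x) (Finset.prod_nonneg fun i _ => h0 i x _))
          fun x => ?_
        refine mul_le_mul (ht1 x) ?_ (Finset.prod_nonneg fun i _ => h0 i x _)
          ((ht0 x).trans (ht1 x))
        simpa using Finset.prod_le_prod (s := Finset.univ)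
          (fun i _ => h0 i x (z.2 i)) fun i _ => h2 i x (z.2 i)

end Memoryless

/-! ### The bias of the output of a binary-input channel -/

/-- The equal mixture of two measures. -/
def mixture {α : Type*} [MeasurableSpace α] (P Q : Measure α) : Measure α :=
  (2⁻¹ : ℝ≥0∞) • (P + Q)

section Mixture

variable {α β : Type*} [MeasurableSpace α] [MeasurableSpace β]

lemma mixture_comm (P Q : Measure α) : mixture P Q = mixture Q P := by
  rw [mixture, mixture, add_comm]

lemma map_mixture {P Q : Measure α} {f : α → β} (hf : Measurable f) :
    (mixture P Q).map f = mixture (P.map f) (Q.map f) := by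
  rw [mixture, mixture, Measure.map_smul, Measure.map_add _ _ hf]

instance isProbabilityMeasure_mixture (P Q : Measure α) [IsProbabilityMeasure P]
    [IsProbabilityMeasure Q] : IsProbabilityMeasure (mixture P Q) := by
  refine ⟨?_⟩
  simp only [mixture, Measure.smul_apply, Measure.add_apply, measure_univ, smul_eq_mul]
  rw [one_add_one_eq_two, ENNReal.inv_mul_cancel two_ne_zero ENNReal.ofNat_ne_top]

lemma two_smul_mixture (P Q : Measure α) : (2 : ℝ≥0∞) • mixture P Q = P + Q := by
  rw [mixture, smul_smul, ENNReal.mul_inv_cancel two_ne_zero ENNReal.ofNat_ne_top, one_smul]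

/-- The densities of `P` and `Q` relative to their mixture add up to `2` almost everywhere, so they
have the form `1 ± m`. -/
lemma exists_bias (P Q : Measure α) [IsProbabilityMeasure P] [IsProbabilityMeasure Q] :
    ∃ m : α → ℝ, Measurable m ∧ (∀ y, |m y| ≤ 1) ∧
      P = (mixture P Q).withDensity (fun y => ENNReal.ofReal (1 + m y)) ∧
      Q = (mixture P Q).withDensity (fun y => ENNReal.ofReal (1 - m y)) := by
  set μ := mixture P Q with hμ
  have h2 := two_smul_mixture P Q
  rw [← hμ] at h2
  have hP : P ≪ μ := by
    refine (Measure.absolutelyContinuous_of_le (Measure.le_add_right le_rfl : P ≤ P + Q)).trans ?_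
    rw [← h2]; exact Measure.smul_absolutelyContinuous
  have hQ : Q ≪ μ := by
    refine (Measure.absolutelyContinuous_of_le (Measure.le_add_left le_rfl : Q ≤ P + Q)).trans ?_
    rw [← h2]; exact Measure.smul_absolutelyContinuous
  have hf := Measure.measurable_rnDeriv P μ
  have hg := Measure.measurable_rnDeriv Q μ
  have hPd := Measure.withDensity_rnDeriv_eq P μ hP
  have hQd := Measure.withDensity_rnDeriv_eq Q μ hQ
  have hsum : (fun y => P.rnDeriv μ y + Q.rnDeriv μ y) =ᵐ[μ] fun _ => 2 := by
    refine (withDensity_eq_iff_of_sigmaFinite (hf.add hg).aemeasurable aemeasurable_const).1 ?_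
    rw [withDensity_const, h2, withDensity_add_left hf, hPd, hQd]
  -- Clamping changes `m` on a null set only and makes the bound hold at every point.
  refine ⟨fun y => max (-1) (min 1 ((P.rnDeriv μ y).toReal - 1)), ?_, fun y => ?_, ?_, ?_⟩
  · exact measurable_const.max (measurable_const.min (hf.ennreal_toReal.sub_const 1))
  · rw [abs_le]
    exact ⟨le_max_left _ _, max_le (by norm_num) (min_le_left _ _)⟩
  all_goals
    refine Eq.trans (by first | exact hPd.symm | exact hQd.symm) (withDensity_congr_ae ?_)
    filter_upwards [hsum] with y hy
    have hfin : P.rnDeriv μ y ≠ ∞ := fun h => by simp [h] at hy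
    have hfin' : Q.rnDeriv μ y ≠ ∞ := fun h => by simp [h] at hy
    have hr : (P.rnDeriv μ y).toReal + (Q.rnDeriv μ y).toReal = 2 := by
      rw [← ENNReal.toReal_add hfin hfin', hy]; simp
    have h0 := (ENNReal.toReal_nonneg : 0 ≤ (P.rnDeriv μ y).toReal)
    have h0' := (ENNReal.toReal_nonneg : 0 ≤ (Q.rnDeriv μ y).toReal)
    rw [min_eq_right (by linarith), max_eq_right (by linarith)]
    first
    | rw [show 1 + ((P.rnDeriv μ y).toReal - 1) = (P.rnDeriv μ y).toReal by ring,
        ENNReal.ofReal_toReal hfin]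
    | rw [show 1 - ((P.rnDeriv μ y).toReal - 1) = (Q.rnDeriv μ y).toReal by linarith,
        ENNReal.ofReal_toReal hfin']

lemma ae_eq_of_withDensity_one_add_eq {μ : Measure α} [IsProbabilityMeasure μ] {m m' : α → ℝ}
    (hm : Measurable m) (hm' : Measurable m') (h1 : ∀ y, |m y| ≤ 1) (h1' : ∀ y, |m' y| ≤ 1)
    (h : μ.withDensity (fun y => ENNReal.ofReal (1 + m y)) =
      μ.withDensity (fun y => ENNReal.ofReal (1 + m' y))) : m =ᵐ[μ] m' := by
  have := (withDensity_eq_iff_of_sigmaFinite (by fun_prop) (by fun_prop)).1 h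
  filter_upwards [this] with y hy
  have e := (ENNReal.ofReal_eq_ofReal_iff (by linarith [(abs_le.1 (h1 y)).1])
    (by linarith [(abs_le.1 (h1' y)).1])).1 hy
  linarith

lemma withDensity_compProd_left (μ : Measure α) [SFinite μ] (κ : Kernel α β) [IsMarkovKernel κ]
    {f : α → ℝ≥0∞} (hf : Measurable f) [SFinite (μ.withDensity f)] :
    μ.withDensity f ⊗ₘ κ = (μ ⊗ₘ κ).withDensity fun p => f p.1 := by
  ext s hs
  have hF : Measurable fun p : α × β => f p.1 := hf.comp measurable_fst
  have hk : Measurable fun a => κ a (Prod.mk a ⁻¹' s) := Kernel.measurable_kernel_prodMk_left hs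
  rw [Measure.compProd_apply hs, withDensity_apply _ hs, ← lintegral_indicator hs,
    Measure.lintegral_compProd (hF.indicator hs),
    lintegral_withDensity_eq_lintegral_mul _ hf hk]
  refine lintegral_congr fun a => ?_
  have : ∀ b, s.indicator (fun p : α × β => f p.1) (a, b) =
      (Prod.mk a ⁻¹' s).indicator (fun _ => f a) b := fun b => rfl
  simp only [this, Pi.mul_apply]
  rw [lintegral_indicator (measurable_prodMk_left hs), setLIntegral_const]

/-- The bias of a pair of measures has a symmetric law if an involution swaps the measures. -/
lemma map_neg_of_swap {P Q : Measure α} [IsProbabilityMeasure P] [IsProbabilityMeasure Q]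
    {m : α → ℝ} (hm : Measurable m) (h1 : ∀ y, |m y| ≤ 1)
    (hP : P = (mixture P Q).withDensity fun y => ENNReal.ofReal (1 + m y))
    (hQ : Q = (mixture P Q).withDensity fun y => ENNReal.ofReal (1 - m y))
    (e : α ≃ᵐ α) (heP : P.map e = Q) (heQ : Q.map e = P) :
    ((mixture P Q).map m).map (fun r => -r) = (mixture P Q).map m := by
  set μ := mixture P Q with hμ
  have hmap : μ.map e = μ := by
    rw [hμ, map_mixture e.measurable, heP, heQ, mixture_comm]
  have hmp : MeasurePreserving e μ μ := ⟨e.measurable, hmap⟩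
  -- The density of `P` at `y` is that of `Q` at `e y`; uniqueness of densities then gives `m ∘ e =
  -- -m` almost everywhere.
  have hQ' : P = μ.withDensity fun y => ENNReal.ofReal (1 + -m (e y)) := by
    ext s hs
    have h2 : P s = Q (e.symm ⁻¹' s) := by
      rw [← heP, Measure.map_apply e.measurable (e.symm.measurable hs), ← preimage_comp]
      simp
    have hs' := e.symm.measurable hs
    rw [h2, hQ, withDensity_apply _ hs', withDensity_apply _ hs,
      ← hmp.setLIntegral_comp_preimage hs'
        (f := fun a => ENNReal.ofReal (1 - m a)) (by fun_prop),
      ← preimage_comp]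
    simp [sub_eq_add_neg]
  have hae : m =ᵐ[μ] fun y => -m (e y) :=
    ae_eq_of_withDensity_one_add_eq hm (hm.comp e.measurable).neg h1
      (fun y => by rw [abs_neg]; exact h1 _) (hP.symm.trans hQ')
  rw [Measure.map_map measurable_neg hm, Measure.map_congr hae,
    show ((fun r : ℝ => -r) ∘ m) = fun y => -m y from rfl]
  have h3 : μ.map (fun y => -m (e y)) = (μ.map e).map (fun y => -m y) :=
    (Measure.map_map hm.neg e.measurable).symm
  rw [h3, hmap]

end Mixture

/-- The sign of a bit. -/
def bitSign (x : ZMod 2) : ℝ := if x = 0 then 1 else -1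

/-- The output of the channel `W` has bias `m` under `μ`, with symmetric law. -/
structure HasBias {𝒴 : Type*} [MeasurableSpace 𝒴] (W : Kernel (ZMod 2) 𝒴) (μ : Measure 𝒴)
    (m : 𝒴 → ℝ) : Prop where
  measurable : Measurable m
  abs_le_one : ∀ y, |m y| ≤ 1
  apply_eq : ∀ x, W x = μ.withDensity fun y => ENNReal.ofReal (1 + bitSign x * m y)
  isBiasLaw : IsBiasLaw (μ.map m)

lemma zmod_two_eq (x : ZMod 2) : x = 0 ∨ x = 1 := by
  revert x; decide

lemma hasBias_mixture {𝒴 : Type*} [MeasurableSpace 𝒴] {W : Kernel (ZMod 2) 𝒴}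
    [IsMarkovKernel W] {m : 𝒴 → ℝ} (hm : Measurable m) (h1 : ∀ y, |m y| ≤ 1)
    (h0 : W 0 = (mixture (W 0) (W 1)).withDensity fun y => ENNReal.ofReal (1 + m y))
    (h1' : W 1 = (mixture (W 0) (W 1)).withDensity fun y => ENNReal.ofReal (1 - m y))
    (hs : ((mixture (W 0) (W 1)).map m).map (fun r => -r) = (mixture (W 0) (W 1)).map m) :
    HasBias W (mixture (W 0) (W 1)) m := by
  refine ⟨hm, h1, fun x => ?_, Measure.isProbabilityMeasure_map hm.aemeasurable, ?_, hs⟩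
  · rcases zmod_two_eq x with rfl | rfl
    · simpa [bitSign] using h0
    · simpa [bitSign, sub_eq_add_neg] using h1'
  · refine (ae_map_iff hm.aemeasurable
      (measurableSet_le (by fun_prop : Measurable fun r : ℝ => |r|) measurable_const)).2 ?_
    exact ae_of_all _ h1

/-- Adding `1` to the first component. -/
def flipBit : ZMod 2 × unitInterval ≃ᵐ ZMod 2 × unitInterval where
  toFun p := (1 + p.1, p.2)
  invFun p := (1 + p.1, p.2)
  left_inv p := by
    rcases zmod_two_eq p.1 with h | h <;> ext <;> simp [h, show (1 + 1 : ZMod 2) = 0 from rfl]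
  right_inv p := by
    rcases zmod_two_eq p.1 with h | h <;> ext <;> simp [h, show (1 + 1 : ZMod 2) = 0 from rfl]
  measurable_toFun := ((Measurable.of_discrete (f := fun z : ZMod 2 => 1 + z)).comp
    measurable_fst).prodMk measurable_snd
  measurable_invFun := ((Measurable.of_discrete (f := fun z : ZMod 2 => 1 + z)).comp
    measurable_fst).prodMk measurable_snd

/-- For a sufficient statistic, the likelihood ratio of the output is that of the statistic. -/
lemma map_bias_of_isSufficient {𝒴 S : Type*} [MeasurableSpace 𝒴] [MeasurableSpace S]
    {W : Kernel (ZMod 2) 𝒴} [IsMarkovKernel W] {κ : Kernel 𝒴 S} [IsMarkovKernel κ]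
    (hsuf : IsSufficient W κ) {m : 𝒴 → ℝ} (hm : Measurable m) (hm1 : ∀ y, |m y| ≤ 1)
    (hW : W 0 = (mixture (W 0) (W 1)).withDensity fun y => ENNReal.ofReal (1 + m y))
    {l : S → ℝ} (hl : Measurable l) (hl1 : ∀ s, |l s| ≤ 1)
    (hL : (W 0 ⊗ₘ κ).snd = (mixture (W 0 ⊗ₘ κ).snd (W 1 ⊗ₘ κ).snd).withDensity
      fun s => ENNReal.ofReal (1 + l s)) :
    (mixture (W 0) (W 1)).map m = (mixture (W 0 ⊗ₘ κ).snd (W 1 ⊗ₘ κ).snd).map l := by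
  set μ := mixture (W 0) (W 1) with hμ
  set L := mixture (W 0 ⊗ₘ κ).snd (W 1 ⊗ₘ κ).snd with hLdef
  have hJ : μ ⊗ₘ κ = mixture (W 0 ⊗ₘ κ) (W 1 ⊗ₘ κ) := by
    rw [hμ, mixture, mixture, Measure.compProd_smul_left, Measure.compProd_add_left]
  have hJsnd : (μ ⊗ₘ κ).map Prod.snd = L := by
    rw [hJ, map_mixture measurable_snd]; rfl
  have hJfst : (μ ⊗ₘ κ).map Prod.fst = μ := Measure.fst_compProd μ κ
  have hd1 : W 0 ⊗ₘ κ = (μ ⊗ₘ κ).withDensity fun p => ENNReal.ofReal (1 + m p.1) := by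
    have hF : Measurable fun y => ENNReal.ofReal (1 + m y) :=
      (measurable_const.add hm).ennreal_ofReal
    have hsf : SFinite (μ.withDensity fun y => ENNReal.ofReal (1 + m y)) := by
      rw [← hW]; infer_instance
    rw [← withDensity_compProd_left μ κ hF, ← hW]
  have hG : Measurable fun s => ENNReal.ofReal (1 + l s) :=
    (measurable_const.add hl).ennreal_ofReal
  -- Sufficiency: the conditional law of the output given the statistic is common to both inputs, so
  -- the joint density depends on the statistic alone. Comparison with `hd1` gives `m = l` almost
  -- surely.
  have hd2 : W 0 ⊗ₘ κ = (μ ⊗ₘ κ).withDensity fun p => ENNReal.ofReal (1 + l p.2) := by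
    refine Measure.ext_prod fun {B D} hB hD => ?_
    obtain ⟨g, hg, hgB⟩ := hsuf B hB
    have hr : ((μ ⊗ₘ κ).restrict (B ×ˢ univ)).map Prod.snd = L.withDensity g := by
      ext D hD
      rw [Measure.map_apply measurable_snd hD, Measure.restrict_apply (measurable_snd hD),
        withDensity_apply _ hD]
      have : Prod.snd ⁻¹' D ∩ B ×ˢ (univ : Set S) = B ×ˢ D := by
        ext p; simp [and_comm]
      rw [this, hJ, hLdef, mixture, mixture, Measure.restrict_smul, lintegral_smul_measure,
        Measure.restrict_add, lintegral_add_measure, Measure.smul_apply, Measure.add_apply,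
        hgB 0 D hD, hgB 1 D hD]
    have hset : Prod.snd ⁻¹' D ∩ B ×ˢ (univ : Set S) = B ×ˢ D := by
      ext p; simp [and_comm]
    rw [hgB 0 D hD, hL, withDensity_apply _ (hB.prod hD), ← hset,
      ← Measure.restrict_restrict (measurable_snd hD),
      ← setLIntegral_map hD hG measurable_snd, hr,
      restrict_withDensity hD, restrict_withDensity hD,
      lintegral_withDensity_eq_lintegral_mul _ hG hg,
      lintegral_withDensity_eq_lintegral_mul _ hg hG]
    exact lintegral_congr fun s => mul_comm _ _
  have hae := ae_eq_of_withDensity_one_add_eq (μ := μ ⊗ₘ κ) (hm.comp measurable_fst)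
    (hl.comp measurable_snd) (fun p => hm1 p.1) (fun p => hl1 p.2) (hd1.symm.trans hd2)
  calc μ.map m = ((μ ⊗ₘ κ).map Prod.fst).map m := by rw [hJfst]
    _ = (μ ⊗ₘ κ).map (m ∘ Prod.fst) := Measure.map_map hm measurable_fst
    _ = (μ ⊗ₘ κ).map (l ∘ Prod.snd) := Measure.map_congr hae
    _ = ((μ ⊗ₘ κ).map Prod.snd).map l := (Measure.map_map hl measurable_snd).symm
    _ = L.map l := by rw [hJsnd]

/-- Flipping the bit exchanges the two laws of the statistic, so its bias is symmetric; sufficiency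
transfers this to the output. -/
lemma IsBMS.exists_hasBias {𝒴 : Type*} [MeasurableSpace 𝒴] {W : Kernel (ZMod 2) 𝒴}
    [IsMarkovKernel W] (hW : IsBMS W) :
    ∃ m : 𝒴 → ℝ, HasBias W (mixture (W 0) (W 1)) m := by
  obtain ⟨κ, Q, hκ, hQ, hsuf, -, hsnd⟩ := hW
  obtain ⟨m, hm, hm1, h0, h1⟩ := exists_bias (W 0) (W 1)
  obtain ⟨l, hl, hl1, hl0, hl1'⟩ := exists_bias (W 0 ⊗ₘ κ).snd (W 1 ⊗ₘ κ).snd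
  refine ⟨m, hasBias_mixture hm hm1 h0 h1 ?_⟩
  rw [map_bias_of_isSufficient hsuf hm hm1 h0 hl hl1 hl0]
  have e0 : (W 0 ⊗ₘ κ).snd = Q := by simp [hsnd]
  have e1 : (W 1 ⊗ₘ κ).snd = Q.map flipBit := hsnd 1
  have e2 : (W 1 ⊗ₘ κ).snd.map flipBit = (W 0 ⊗ₘ κ).snd := by
    rw [e1, e0, Measure.map_map flipBit.measurable flipBit.measurable]
    have : (flipBit ∘ flipBit : ZMod 2 × unitInterval → _) = id := funext flipBit.left_inv
    rw [this, Measure.map_id]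
  exact map_neg_of_swap hl hl1 hl0 hl1' flipBit (by rw [e0, e1]) e2

/-- The bias of the output of the binary erasure channel. -/
def becBias : ZMod 2 ⊕ Unit → ℝ := Sum.elim bitSign fun _ => 0

lemma measurable_becBias : Measurable becBias :=
  measurable_fun_sum Measurable.of_discrete measurable_const

lemma bec_apply (t : ℝ) (x : ZMod 2) : bec t x =
    ENNReal.ofReal t • Measure.dirac (Sum.inl x) +
      ENNReal.ofReal (1 - t) • Measure.dirac (Sum.inr ()) := rfl

lemma isMarkovKernel_bec {t : ℝ} (ht : t ∈ Icc (0 : ℝ) 1) : IsMarkovKernel (bec t) := by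
  refine ⟨fun x => ⟨?_⟩⟩
  simp only [bec_apply, Measure.add_apply, Measure.smul_apply, measure_univ, smul_eq_mul, mul_one]
  rw [← ENNReal.ofReal_add ht.1 (by linarith [ht.2])]
  norm_num

lemma inv_two_mul_two_mul (a : ℝ≥0∞) : 2⁻¹ * (2 * a) = a := by
  rw [← mul_assoc, ENNReal.inv_mul_cancel two_ne_zero ENNReal.ofNat_ne_top, one_mul]

lemma map_becBias (t : ℝ) : (mixture (bec t 0) (bec t 1)).map becBias = becLaw t := by
  have hd : ∀ y, (Measure.dirac y).map becBias = Measure.dirac (becBias y) := fun y =>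
    Measure.map_dirac' measurable_becBias y
  have h2 : ENNReal.ofReal (t / 2) = 2⁻¹ * ENNReal.ofReal t := by
    rw [ENNReal.ofReal_div_of_pos two_pos, div_eq_mul_inv, mul_comm]; simp
  rw [map_mixture measurable_becBias]
  simp only [bec_apply, Measure.map_add _ _ measurable_becBias, Measure.map_smul, hd]
  ext s hs
  simp only [mixture, becLaw, becBias, bitSign, Sum.elim_inl, Sum.elim_inr, Measure.smul_apply,
    Measure.add_apply, smul_eq_mul, h2, if_true, one_ne_zero, if_false]
  conv_rhs => rw [← inv_two_mul_two_mul (ENNReal.ofReal (1 - t) * Measure.dirac (0 : ℝ) s)]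
  ring

lemma hasBias_bec {t : ℝ} (ht : t ∈ Icc (0 : ℝ) 1) :
    HasBias (bec t) (mixture (bec t 0) (bec t 1)) becBias := by
  have hm := measurable_becBias
  have key : ∀ f : ZMod 2 ⊕ Unit → ℝ≥0∞, Measurable f →
      ∫⁻ y, f y ∂(mixture (bec t 0) (bec t 1)) = 2⁻¹ *
        (ENNReal.ofReal t * f (Sum.inl 0) + ENNReal.ofReal (1 - t) * f (Sum.inr ()) +
          (ENNReal.ofReal t * f (Sum.inl 1) + ENNReal.ofReal (1 - t) * f (Sum.inr ()))) := by
    intro f hf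
    simp only [mixture, bec_apply, lintegral_smul_measure, lintegral_add_measure,
      lintegral_dirac' _ hf, smul_eq_mul]
  refine ⟨hm, fun y => ?_, fun x => ?_, ?_⟩
  · rcases y with x | y
    · simp only [becBias, bitSign, Sum.elim_inl]; split_ifs <;> simp
    · simp [becBias]
  · refine Measure.ext_of_lintegral _ fun f hf => ?_
    rw [lintegral_withDensity_eq_lintegral_mul _ (by fun_prop) hf, key _ (by fun_prop)]
    simp only [bec_apply, lintegral_smul_measure, lintegral_add_measure,
      lintegral_dirac' _ hf, smul_eq_mul, Pi.mul_apply, becBias, Sum.elim_inl, Sum.elim_inr,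
      mul_zero, add_zero, ENNReal.ofReal_one, one_mul]
    rw [← inv_two_mul_two_mul (ENNReal.ofReal t * f (Sum.inl x) + _)]
    congr 1
    have h2 : ENNReal.ofReal (1 + 1) = 2 := by norm_num
    rcases zmod_two_eq x with rfl | rfl <;> simp [bitSign, h2] <;> ring
  · rw [map_becBias]; exact isBiasLaw_becLaw ht

/-! ### Capacity and information of a channel with a symmetric bias -/

lemma isSign_bitSign : IsSign bitSign := fun x => by
  rcases zmod_two_eq x with rfl | rfl <;> simp [bitSign]

lemma isSign_coord {n : ℕ} (i : Fin n) : IsSign fun x : Fin n → ZMod 2 => bitSign (x i) :=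
  fun x => isSign_bitSign (x i)

section Channel

variable {𝒴 : Type*} [MeasurableSpace 𝒴] {W : Kernel (ZMod 2) 𝒴} {μ : Measure 𝒴} {m : 𝒴 → ℝ}

lemma HasBias.density_nonneg (hW : HasBias W μ m) (x : ZMod 2) (y : 𝒴) :
    0 ≤ 1 + bitSign x * m y := by
  linarith [(abs_le.1 (isSign_bitSign.abs_mul_le (hW.abs_le_one y) x)).1]

lemma HasBias.density_le (hW : HasBias W μ m) (x : ZMod 2) (y : 𝒴) :
    1 + bitSign x * m y ≤ 2 := by
  linarith [(abs_le.1 (isSign_bitSign.abs_mul_le (hW.abs_le_one y) x)).2]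

lemma HasBias.channelInfo_eq [IsProbabilityMeasure μ] [IsMarkovKernel W] (hW : HasBias W μ m)
    (P : Measure (ZMod 2)) [IsProbabilityMeasure P] :
    channelInfo P W = ENNReal.ofReal
      ((∫ r, (deficit r - deficit (bias bitSign (fun x => P.real {x}) * r)) ∂(μ.map m)) /
        Real.log 2) := by
  have hm := hW.measurable
  have h0 : ∀ x : ZMod 2, 0 ≤ P.real {x} := fun x => measureReal_nonneg
  rw [channelInfo_eq_of_density P μ W (g := fun x y => 1 + bitSign x * m y)
    (fun x => by fun_prop) hW.density_nonneg hW.density_le hW.apply_eq]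
  have h1 : ∫ y, negEntropy (fun x => P.real {x} * (1 + bitSign x * m y)) ∂μ =
      step (μ.map m) bitSign negEntropy fun x => P.real {x} := by
    exact (integral_map hm.aemeasurable (isRegular_negEntropy.measurable.comp
      (measurable_tilt_left bitSign fun x => P.real {x})).aestronglyMeasurable).symm
  rw [h1, step_negEntropy hW.isBiasLaw isSign_bitSign h0, sum_real_singleton, one_mul,
    add_sub_cancel_left]

/-- The loss `E d(bm)` is nonnegative and vanishes at `b = 0`, so the uniform input is optimal. -/
lemma HasBias.capacity_eq [IsProbabilityMeasure μ] [IsMarkovKernel W] (hW : HasBias W μ m) :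
    capacity W = ENNReal.ofReal ((∫ r, deficit r ∂(μ.map m)) / Real.log 2) := by
  have hl : 0 < Real.log 2 := Real.log_pos one_lt_two
  have hν := hW.isBiasLaw
  refine le_antisymm (iSup₂_le fun P hP => ?_) ?_
  · rw [hW.channelInfo_eq P]
    refine ENNReal.ofReal_le_ofReal (div_le_div_of_nonneg_right ?_ hl.le)
    have hb : |bias bitSign fun x => P.real {x}| ≤ 1 :=
      isSign_bitSign.abs_bias_le fun x => measureReal_nonneg
    refine integral_mono_ae (hν.integrable_deficit.sub (hν.integrable_deficit_mul hb))
      hν.integrable_deficit ?_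
    filter_upwards [hν.abs_le_one] with r hr
    have := deficit_nonneg (abs_mul_le_one hb hr)
    linarith
  · have hp := isProbabilityMeasure_mixture (Measure.dirac (0 : ZMod 2)) (Measure.dirac 1)
    refine le_trans (le_of_eq ?_) (le_iSup₂ (mixture (Measure.dirac (0 : ZMod 2))
      (Measure.dirac 1)) hp)
    rw [hW.channelInfo_eq]
    have hb : bias bitSign (fun x => (mixture (Measure.dirac (0 : ZMod 2))
        (Measure.dirac 1)).real {x}) = 0 := by
      have h : ∀ f : ZMod 2 → ℝ, ∑ x, f x = f 0 + f 1 := fun f => Fin.sum_univ_two f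
      simp [bias, h, bitSign, mixture, measureReal_def]
    simp [hb, deficit_zero]

lemma isMarkovKernel_memoryless (W : Kernel (ZMod 2) 𝒴) [IsMarkovKernel W] (n : ℕ) :
    IsMarkovKernel (memoryless W n) :=
  ⟨fun x => inferInstanceAs (IsProbabilityMeasure (Measure.pi fun i => W (x i)))⟩

lemma HasBias.channelInfo_memoryless_eq [IsProbabilityMeasure μ] [IsMarkovKernel W]
    (hW : HasBias W μ m) {n : ℕ} (P : Measure (Fin n → ZMod 2)) [IsProbabilityMeasure P] :
    channelInfo P (memoryless W n) = ENNReal.ofReal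
      ((steps (μ.map m) (List.ofFn fun (i : Fin n) (x : Fin n → ZMod 2) => bitSign (x i))
        negEntropy (fun x => P.real {x}) - negEntropy fun x => P.real {x}) / Real.log 2) := by
  have hm := hW.measurable
  have := isMarkovKernel_memoryless W n
  rw [channelInfo_eq_of_density P (Measure.pi fun _ : Fin n => μ) (memoryless W n)
    (g := fun x y => ∏ i, (1 + bitSign (x i) * m (y i))) (R := 2 ^ n) (fun x => by fun_prop)
    (fun x y => Finset.prod_nonneg fun i _ => hW.density_nonneg _ _)
    (fun x y => by
      simpa using Finset.prod_le_prod (s := Finset.univ)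
        (fun i _ => hW.density_nonneg (x i) (y i)) fun i _ => hW.density_le (x i) (y i)) ?_,
    ← integral_pi_eq_steps μ hm hW.abs_le_one hW.isBiasLaw isRegular_negEntropy isSign_coord
      fun x => measureReal_nonneg]
  intro x
  have hsf : ∀ i, SigmaFinite (μ.withDensity fun y => ENNReal.ofReal (1 + bitSign (x i) * m y)) :=
    fun i => by rw [← hW.apply_eq]; infer_instance
  change Measure.pi (fun i => W (x i)) = _
  simp only [hW.apply_eq]
  rw [pi_withDensity μ (f := fun i y => ENNReal.ofReal (1 + bitSign (x i) * m y))
    fun i => by fun_prop]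
  congr 1
  funext y
  exact (ENNReal.ofReal_prod_of_nonneg fun i _ => hW.density_nonneg _ _).symm

end Channel

/-! ### Uniform weights on affine subspaces -/

/-- A constant multiple of the indicator of a set closed under `x + y + z`. -/
def IsAffineWeight {n : ℕ} (w : (Fin n → ZMod 2) → ℝ) : Prop :=
  ∃ (c : ℝ) (K : Set (Fin n → ZMod 2)), 0 ≤ c ∧
    (∀ x ∈ K, ∀ y ∈ K, ∀ z ∈ K, x + y + z ∈ K) ∧ w = K.indicator fun _ => c

section Affine

variable {n : ℕ} {w : (Fin n → ZMod 2) → ℝ}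

lemma IsAffineWeight.nonneg (hw : IsAffineWeight w) (x : Fin n → ZMod 2) : 0 ≤ w x := by
  obtain ⟨c, K, hc, -, rfl⟩ := hw
  exact indicator_nonneg (fun _ _ => hc) x

/-- Revealing a bit cuts the support with the hyperplane `x i = b` and doubles the constant. -/
lemma IsAffineWeight.restrict (hw : IsAffineWeight w) (i : Fin n) (b : ZMod 2) {e : ℝ}
    (he : ∀ x : Fin n → ZMod 2, 1 + bitSign (x i) * e = if x i = b then 2 else 0) :
    IsAffineWeight (tilt (fun x => bitSign (x i)) e w) := by
  obtain ⟨c, K, hc, hK, rfl⟩ := hw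
  refine ⟨c * 2, K ∩ {x | x i = b}, by positivity, ?_, ?_⟩
  · rintro x ⟨hx, hx'⟩ y ⟨hy, hy'⟩ z ⟨hz, hz'⟩
    refine ⟨hK x hx y hy z hz, ?_⟩
    rw [mem_ofPred_eq] at hx' hy' hz' ⊢
    rw [Pi.add_apply, Pi.add_apply, hx', hy', hz', CharTwo.add_self_eq_zero, zero_add]
  · funext x
    rw [tilt, he]
    by_cases hx : x ∈ K <;> by_cases hb : x i = b <;> simp [hx, hb]

lemma IsAffineWeight.tilt_one (hw : IsAffineWeight w) (i : Fin n) :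
    IsAffineWeight (tilt (fun x => bitSign (x i)) 1 w) :=
  hw.restrict i 0 fun x => by
    rcases zmod_two_eq (x i) with h | h <;> simp [bitSign, h, one_add_one_eq_two]

lemma IsAffineWeight.tilt_neg_one (hw : IsAffineWeight w) (i : Fin n) :
    IsAffineWeight (tilt (fun x => bitSign (x i)) (-1) w) :=
  hw.restrict i 1 fun x => by
    rcases zmod_two_eq (x i) with h | h <;> simp [bitSign, h, one_add_one_eq_two]

lemma bitSign_add_one (x : ZMod 2) : bitSign (x + 1) = -bitSign x := by
  rcases zmod_two_eq x with rfl | rfl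
  · simp [bitSign]
  · simp [bitSign, CharTwo.add_self_eq_zero]

/-- Under a uniform law on an affine subspace each coordinate is deterministic or uniform. -/
lemma IsAffineWeight.bias_eq (hw : IsAffineWeight w) (i : Fin n) :
    bias (fun x => bitSign (x i)) w = 0 ∨ bias (fun x => bitSign (x i)) w ^ 2 = 1 := by
  obtain ⟨c, K, hc, hK, rfl⟩ := hw
  by_cases h : ∃ a ∈ K, ∃ b ∈ K, a i = 0 ∧ b i = 1
  · left
    obtain ⟨a, ha, b, hb, ha0, hb1⟩ := h
    -- Translation by `a + b` preserves `K` and flips coordinate `i`, so the signed sum equals its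
    -- own negative.
    have hmem : ∀ x, x + (a + b) ∈ K ↔ x ∈ K := by
      have h1 : ∀ x ∈ K, x + (a + b) ∈ K := fun x hx => by
        rw [← add_assoc]; exact hK x hx a ha b hb
      refine fun x => ⟨fun hx => ?_, h1 x⟩
      have h2 := h1 _ hx
      have h3 : a + b + (a + b) = 0 := by
        funext j; exact CharTwo.add_self_eq_zero ((a + b) j)
      rwa [add_assoc, h3, add_zero] at h2
    have hsum : ∑ x, bitSign (x i) * K.indicator (fun _ => c) x =
        -∑ x, bitSign (x i) * K.indicator (fun _ => c) x := by
      conv_lhs => rw [← Equiv.sum_comp (Equiv.addRight (a + b))]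
      rw [← Finset.sum_neg_distrib]
      refine Finset.sum_congr rfl fun x _ => ?_
      have h1 : (x + (a + b)) i = x i + 1 := by simp [ha0, hb1]
      have h2 : K.indicator (fun _ => c) (x + (a + b)) = K.indicator (fun _ => c) x := by
        by_cases hx : x ∈ K
        · rw [indicator_of_mem hx, indicator_of_mem ((hmem x).2 hx)]
        · rw [indicator_of_notMem hx, indicator_of_notMem fun h => hx ((hmem x).1 h)]
      simp only [Equiv.coe_addRight]
      rw [h1, h2, bitSign_add_one, neg_mul]
    rw [bias, self_eq_neg.1 hsum, zero_div]
  · obtain ⟨e, he, hs⟩ : ∃ e : ℝ, e ^ 2 = 1 ∧ ∀ x ∈ K, bitSign (x i) = e := by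
      by_cases h0 : ∃ a ∈ K, a i = 0
      · obtain ⟨a, ha, ha0⟩ := h0
        refine ⟨1, one_pow 2, fun x hx => ?_⟩
        rcases zmod_two_eq (x i) with h' | h'
        · simp [bitSign, h']
        · exact absurd ⟨a, ha, x, hx, ha0, h'⟩ h
      · refine ⟨-1, by norm_num, fun x hx => ?_⟩
        have : x i ≠ 0 := fun h' => h0 ⟨x, hx, h'⟩
        simp [bitSign, this]
    have hsum : ∑ x, bitSign (x i) * K.indicator (fun _ => c) x =
        e * ∑ x, K.indicator (fun _ => c) x := by
      rw [Finset.mul_sum]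
      refine Finset.sum_congr rfl fun x _ => ?_
      by_cases hx : x ∈ K
      · rw [hs x hx]
      · simp [hx]
    rw [bias, hsum]
    rcases eq_or_ne (∑ x, K.indicator (fun _ => c) x) 0 with h0 | h0
    · left; rw [h0, div_zero]
    · right; rw [mul_div_cancel_right₀ _ h0, he]

lemma isProbabilityMeasure_unifShiftedCode (C : Submodule (ZMod 2) (Fin n → ZMod 2))
    (u : Fin n → ZMod 2) : IsProbabilityMeasure (unifShiftedCode C u) :=
  isProbabilityMeasure_uniformOn (Set.toFinite _) ⟨0 + u, 0, C.zero_mem, rfl⟩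

lemma isAffineWeight_unifShiftedCode (C : Submodule (ZMod 2) (Fin n → ZMod 2))
    (u : Fin n → ZMod 2) : IsAffineWeight fun x => (unifShiftedCode C u).real {x} := by
  set K : Set (Fin n → ZMod 2) := (fun c => c + u) '' (C : Set (Fin n → ZMod 2)) with hK
  refine ⟨((Measure.count K)⁻¹).toReal, K, ENNReal.toReal_nonneg, ?_, ?_⟩
  · rintro _ ⟨x, hx, rfl⟩ _ ⟨y, hy, rfl⟩ _ ⟨z, hz, rfl⟩
    refine ⟨x + y + z, C.add_mem (C.add_mem hx hy) hz, ?_⟩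
    have h : u + u = 0 := by funext j; exact CharTwo.add_self_eq_zero (u j)
    have : x + u + (y + u) + (z + u) = x + y + z + (u + u) + u := by abel
    rw [this, h, add_zero]
  · funext x
    rw [measureReal_def, unifShiftedCode, ← hK, uniformOn,
      cond_apply (Set.toFinite K).measurableSet]
    by_cases hx : x ∈ K
    · rw [inter_singleton_of_mem hx, Measure.count_singleton, mul_one, indicator_of_mem hx]
    · rw [inter_singleton_of_notMem hx, measure_empty, mul_zero, indicator_of_notMem hx,
        ENNReal.toReal_zero]

end Affine

/-! ### The constants `η` and `α` -/

/-- The witness `d` is the bias of the binary symmetric channel of capacity `t`. The intermediate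
value theorem ensures that `hInv` is a genuine preimage. -/
lemma exists_eta_eq {t : ℝ} (ht : t ∈ Icc (0 : ℝ) 1) :
    ∃ d ∈ Icc (0 : ℝ) 1, eta t = d ^ 2 ∧ deficit d = t * Real.log 2 := by
  have hl : 0 < Real.log 2 := Real.log_pos one_lt_two
  have hcont : ContinuousOn h (Icc 0 (1 / 2)) :=
    (Real.binEntropy_continuous.div_const _).continuousOn
  have h0 : h 0 = 0 := by simp [h]
  have h1 : h (1 / 2) = 1 := by
    rw [h, one_div, Real.binEntropy_two_inv, div_self hl.ne']
  have hmem : 1 - t ∈ h '' Icc 0 (1 / 2) := by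
    refine intermediate_value_Icc (by norm_num) hcont ?_
    rw [h0, h1]
    exact ⟨by linarith [ht.2], by linarith [ht.1]⟩
  have hp : hInv (1 - t) ∈ Icc (0 : ℝ) (1 / 2) := Function.invFunOn_mem hmem
  have hh : h (hInv (1 - t)) = 1 - t := Function.invFunOn_eq hmem
  refine ⟨1 - 2 * hInv (1 - t), ⟨by linarith [hp.2], by linarith [hp.1]⟩, rfl, ?_⟩
  have h2 := binEntropy_eq_sub_deficit (1 - 2 * hInv (1 - t))
  rw [show (1 - (1 - 2 * hInv (1 - t))) / 2 = hInv (1 - t) by ring] at h2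
  rw [h, div_eq_iff hl.ne'] at hh
  linarith

lemma half_logb_lt_alpha {t : ℝ} (ht : t ∈ Icc (0 : ℝ) 1) (h0 : 0 < t) :
    Real.logb 2 (Real.exp 1) / 2 < alpha t := by
  have hl : 0 < Real.log 2 := Real.log_pos one_lt_two
  obtain ⟨d, hd, he, hdef⟩ := exists_eta_eq ht
  have hd0 : d ≠ 0 := by
    rintro rfl
    rw [deficit_zero] at hdef
    exact (mul_pos h0 hl).ne hdef
  have h1 := half_sq_lt_deficit (by rw [abs_of_nonneg hd.1]; exact hd.2) hd0
  rw [hdef] at h1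
  have hd2 : 0 < d ^ 2 := by positivity
  rw [Real.logb, Real.log_exp, alpha, he, div_div, div_lt_div_iff₀ (by positivity) hd2]
  linarith

/-- At a given capacity the binary symmetric channel maximizes `E m²`: Jensen gives `d(√(E m²)) ≤ t
log 2 = d(√η_t)`, and `deficit` is strictly increasing on `[0, 1]`. -/
lemma alpha_le_div_integral_sq {t : ℝ} (ht : t ∈ Icc (0 : ℝ) 1) (h0 : 0 < t) {ν : Measure ℝ}
    (hν : IsBiasLaw ν) (hνt : ∫ m, deficit m ∂ν = t * Real.log 2) :
    alpha t ≤ t / ∫ m, m ^ 2 ∂ν := by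
  have hl : 0 < Real.log 2 := Real.log_pos one_lt_two
  have := hν.isProbabilityMeasure
  obtain ⟨d, hd, he, hdef⟩ := exists_eta_eq ht
  have htη : t ≤ ∫ m, m ^ 2 ∂ν := le_of_mul_le_mul_right (hνt ▸ hν.integral_deficit_le) hl
  have hη0 : 0 < ∫ m, m ^ 2 ∂ν := h0.trans_le htη
  have h1 := deficit_sqrt_integral_le hν.abs_le_one
  rw [hνt, ← hdef] at h1
  have h2 : Real.sqrt (∫ m, m ^ 2 ∂ν) ≤ d := by
    by_contra! hlt
    exact h1.not_gt (deficit_lt_deficit hd.1 hlt (Real.sqrt_le_one.2 hν.integral_sq_le_one))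
  rw [alpha, he]
  exact div_le_div_of_nonneg_left h0.le hη0 (Real.sqrt_le_left hd.1 |>.1 h2)

lemma alpha_zero : alpha 0 = 0 := by simp [alpha]

end BMSComparison

end

/-! ### The comparison theorem -/

open BMSComparison in
theorem corollary2 (t : ℝ) (ht : t ∈ Set.Icc (0 : ℝ) 1) :
    (0 < t → Real.logb 2 (Real.exp 1) / 2 < BMSComparison.alpha t) ∧
    BMSComparison.capacity (BMSComparison.bec t) = ENNReal.ofReal t ∧
    ∀ (n : ℕ) (C : Submodule (ZMod 2) (Fin n → ZMod 2)) (u : Fin n → ZMod 2)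
      (𝒴 : Type*) [MeasurableSpace 𝒴] (W : ProbabilityTheory.Kernel (ZMod 2) 𝒴)
      [ProbabilityTheory.IsMarkovKernel W],
      BMSComparison.IsBMS W →
      BMSComparison.capacity W = ENNReal.ofReal t →
      ENNReal.ofReal (BMSComparison.alpha t) *
          BMSComparison.channelInfo (BMSComparison.unifShiftedCode C u)
            (BMSComparison.memoryless (BMSComparison.bec t) n) ≤
        BMSComparison.channelInfo (BMSComparison.unifShiftedCode C u)
          (BMSComparison.memoryless W n) ∧
      BMSComparison.channelInfo (BMSComparison.unifShiftedCode C u)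
          (BMSComparison.memoryless W n) ≤
        BMSComparison.channelInfo (BMSComparison.unifShiftedCode C u)
          (BMSComparison.memoryless (BMSComparison.bec t) n) := by
  have hl : 0 < Real.log 2 := Real.log_pos one_lt_two
  have hbecM := isMarkovKernel_bec ht
  have hbec := hasBias_bec ht
  refine ⟨half_logb_lt_alpha ht, ?_, ?_⟩
  · rw [hbec.capacity_eq, map_becBias, integral_deficit_becLaw ht, mul_div_cancel_right₀ _ hl.ne']
  intro n C u 𝒴 _ W _ hBMS hcap
  obtain ⟨m, hW⟩ := hBMS.exists_hasBias
  have hν := hW.isBiasLaw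
  have hP := isProbabilityMeasure_unifShiftedCode C u
  have hA := isAffineWeight_unifShiftedCode C u
  rw [hbec.channelInfo_memoryless_eq, hW.channelInfo_memoryless_eq, map_becBias]
  rw [hW.capacity_eq] at hcap
  set ν := (mixture (W 0) (W 1)).map m with hνdef
  set p : (Fin n → ZMod 2) → ℝ := fun x => (unifShiftedCode C u).real {x} with hp
  set l := List.ofFn fun (i : Fin n) (x : Fin n → ZMod 2) => bitSign (x i) with hldef
  have hls : ∀ s ∈ l, ∃ i : Fin n, s = fun x => bitSign (x i) := fun s hs => by
    obtain ⟨i, rfl⟩ := List.mem_ofFn.1 hs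
    exact ⟨i, rfl⟩
  have hl0 : ∀ s ∈ l, IsSign s := fun s hs => by
    obtain ⟨i, rfl⟩ := hls s hs
    exact isSign_coord i
  have hI0 : 0 ≤ ∫ r, deficit r ∂ν := integral_nonneg_of_ae (by
    filter_upwards [hν.abs_le_one] with r hr using deficit_nonneg hr)
  have hνt : ∫ r, deficit r ∂ν = t * Real.log 2 := by
    rwa [ENNReal.ofReal_eq_ofReal_iff (div_nonneg hI0 hl.le) ht.1, div_eq_iff hl.ne'] at hcap
  constructor
  · rcases ht.1.eq_or_lt with h0 | h0
    · simp [← h0, alpha_zero]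
    have hα : 0 ≤ alpha t := div_nonneg h0.le (sq_nonneg _)
    have hα' := alpha_le_div_integral_sq ht h0 hν hνt
    have hmain := mul_steps_becLaw_sub_le_of_capacity hν h0 hνt hl0
      (P := IsAffineWeight) (fun w hw => hw.nonneg)
      (fun s hs w hw => by
        obtain ⟨i, rfl⟩ := hls s hs
        exact ⟨hw.tilt_one i, hw.tilt_neg_one i⟩)
      (fun s hs w hw => by
        obtain ⟨i, rfl⟩ := hls s hs
        exact hw.bias_eq i) hA
    rw [← ENNReal.ofReal_mul hα, mul_div_assoc']
    -- `ENNReal.ofReal` truncates at zero, so a nonpositive difference makes the left side `0` and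
    -- its sign need not be determined.
    rcases le_total 0 (steps (becLaw t) l negEntropy p - negEntropy p) with hX | hX
    · exact ENNReal.ofReal_le_ofReal (div_le_div_of_nonneg_right
        ((mul_le_mul_of_nonneg_right hα' hX).trans hmain) hl.le)
    · rw [ENNReal.ofReal_of_nonpos
        (div_nonpos_of_nonpos_of_nonneg (mul_nonpos_of_nonneg_of_nonpos hα hX) hl.le)]
      exact zero_le
  · exact ENNReal.ofReal_le_ofReal (div_le_div_of_nonneg_right
      (sub_le_sub_right (steps_negEntropy_le hν ht hνt.le hl0 hA.nonneg) _) hl.le)
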